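/- Let UAVs hover at height $h>0$ above the points $X_j$ of a homogeneous Poisson point process $\Psi$ of density $\lambda>0$ in the plane $\mathbb{R}^2$, with a user at the origin, and let $d_j=\sqrt{h^2+\|X_j\|^2}$ be the distance from the user to the $j$-th UAV. Suppose the interfering links undergo Rayleigh fading (Nakagami-$m_I$ fading with $m_I=1$ and unit mean power): the power gains $|g_j|^2$ are i.i.d. exponential with mean $1$ and independent of $\Psi$. Let $P_u>0$ be the transmit power, let the serving distance be $r_t=\sqrt{h^2+r^2}$ for a horizontal distance $r\ge 0$, let $\alpha_I>2$ be the path loss exponent, $\delta_I=2/\alpha_I$, and let $$I=\sum_{j\in\Psi,\ d_j>r_t}|g_j|^2P_u\,d_j^{-\alpha_I}$$ be the interference at the paired users. Then this series converges almost surely, and for every $s\ge 0$ its Laplace transform $\mathcal{L}_t(s)=\mathbb{E}[e^{-sI}]$ is $$\mathcal{L}_t(s)=\exp\left(-\frac{2\pi\lambda\, sP_u\, r_t^{2-\alpha_I}}{\alpha_I(1-\delta_I)}\;{}_2F_1\!\left(1,1-\delta_I;2-\delta_I;-sP_u r_t^{-\alpha_I}\right)\right),$$ where ${}_2F_1$ is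 the Gauss hypergeometric function (continued analytically to all real arguments $<1$). For $\alpha_I=4$ this reduces to $$\mathcal{L}_t(s)=\exp\left(-\pi\lambda\sqrt{sP_u}\,\arctan\left(\frac{\sqrt{sP_u}}{r_t^2}\right)\right).$$ These statements hold for every fixed $r\ge 0$. They also hold when $r=\inf_j\|X_j\|$ is the random horizontal distance to the nearest (serving) UAV, with $\mathcal{L}_t(s)$ then the conditional expectation $\mathbb{E}[e^{-sI}\mid r]$ (equalities almost surely). -/

import Mathlib

open MeasureTheory ProbabilityTheory

noncomputable section

/-- The horizontal plane over which the UAVs are scattered; the typical user sits at its origin. -/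
abbrev Plane : Type := EuclideanSpace ℝ (Fin 2)

/-- The number (possibly infinite) of points of the configuration `x` that lie in `B`. -/
def pointCount (x : ℕ → Plane) (B : Set Plane) : ℕ∞ := {n : ℕ | x n ∈ B}.encard

/-- The random points `X 0, X 1, …` form a homogeneous Poisson point process of density `lam` in
the plane: the number of points in a bounded Borel set `B` has the Poisson law with mean
`lam * area B`, and the numbers of points in disjoint bounded Borel sets are independent. -/
structure IsHPPP {Ω : Type*} [MeasurableSpace Ω] (μ : Measure Ω) (X : ℕ → Ω → Plane)
    (lam : ℝ) : Prop where
  measurable : ∀ n, Measurable (X n)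
  poisson : ∀ B : Set Plane, MeasurableSet B → Bornology.IsBounded B →
    HasLaw (fun ω => pointCount (fun n => X n ω) B)
      ((poissonMeasure (lam * (volume B).toReal).toNNReal).map (fun k : ℕ => (k : ℕ∞))) μ
  indep : ∀ (k : ℕ) (B : Fin k → Set Plane), (∀ i, MeasurableSet (B i)) →
    (∀ i, Bornology.IsBounded (B i)) → Pairwise (fun i j => Disjoint (B i) (B j)) →
    iIndepFun (fun i ω => pointCount (fun n => X n ω) (B i)) μ

/-- The law of the power gain `|g|²` of a Nakagami-`m` fading channel with unit mean power: its
density is `m ^ m * x ^ (m - 1) / Γ(m) * exp (-m * x)` on `x ≥ 0`. Rayleigh fading is `m = 1`. -/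
def nakagamiPowerLaw (m : ℝ) : Measure ℝ := gammaMeasure m m

/-- The UAV network: the horizontal positions `X j` of the UAVs form a homogeneous Poisson point
process of density `lam`; the power gains `G j = |g_j|²` of the channels between the UAVs and the
user are i.i.d. with the Nakagami-`mI` power law, and independent of the positions. -/
structure IsUAVNetwork {Ω : Type*} [MeasurableSpace Ω] (μ : Measure Ω) (X : ℕ → Ω → Plane)
    (G : ℕ → Ω → ℝ) (lam mI : ℝ) : Prop where
  hppp : IsHPPP μ X lam
  gain_measurable : ∀ j, Measurable (G j)
  gain_law : ∀ j, HasLaw (G j) (nakagamiPowerLaw mI) μ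
  gain_indep : iIndepFun G μ
  gain_indep_positions : IndepFun (fun ω j => X j ω) (fun ω j => G j ω) μ

/-- Distance between the user and a UAV at height `h` and horizontal distance `r`. -/
def linkDist (h r : ℝ) : ℝ := √(h ^ 2 + r ^ 2)

/-- Horizontal distance from the user at the origin to the nearest UAV. -/
def nearestDist (x : ℕ → Plane) : ℝ := ⨅ j, ‖x j‖

/-- Contribution of the `j`-th UAV to the interference when the serving UAV is at horizontal
distance `r`: it is `|g_j|² P d_j ^ (-αI)` if `d_j > r_t`, and zero otherwise. -/
def interferenceTerm (P αI h r : ℝ) (x : ℕ → Plane) (G : ℕ → ℝ) (j : ℕ) : ℝ :=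
  if linkDist h r < linkDist h ‖x j‖ then G j * P * linkDist h ‖x j‖ ^ (-αI) else 0

/-- The total interference `I = ∑_{j : d_j > r_t} |g_j|² P d_j ^ (-αI)`. -/
def interference (P αI h r : ℝ) (x : ℕ → Plane) (G : ℕ → ℝ) : ℝ :=
  ∑' j, interferenceTerm P αI h r x G j

/-- `F` is, on the half-line `z < 1`, the analytic continuation of the Gauss hypergeometric series
`∑ (a)_n (b)_n / (c)_n * z ^ n / n!` from the interval `|z| < 1`. -/
def IsGaussContinuation (a b c : ℝ) (F : ℝ → ℝ) : Prop :=
  AnalyticOnNhd ℝ F (Set.Iio 1) ∧ ∀ z : ℝ, |z| < 1 → F z = ordinaryHypergeometric a b c z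

open Classical in
/-- The Gauss hypergeometric function `₂F₁(a, b; c; z)` for real parameters and real `z < 1`:
the analytic continuation of the Gauss series. -/
def gauss2F1 (a b c z : ℝ) : ℝ :=
  if H : ∃ F, IsGaussContinuation a b c F then H.choose z else 0

/-- The continuation is unique, so that `gauss2F1` does not depend on any choice. -/
theorem gauss2F1_eq {a b c : ℝ} {F : ℝ → ℝ} (hF : IsGaussContinuation a b c F) {z : ℝ}
    (hz : z < 1) : gauss2F1 a b c z = F z := by
  have H : ∃ F, IsGaussContinuation a b c F := ⟨F, hF⟩
  rw [gauss2F1, dif_pos H]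
  refine H.choose_spec.1.eqOn_of_preconnected_of_eventuallyEq hF.1 isPreconnected_Iio
    (z₀ := 0) (by simp) ?_ hz
  filter_upwards [Metric.ball_mem_nhds (0 : ℝ) one_pos] with w hw
  have hw' : |w| < 1 := by simpa using hw
  rw [H.choose_spec.2 w hw', hF.2 w hw']

end

section

open Set Filter Topology
open scoped ENNReal NNReal

/-! ### The Gauss hypergeometric function `₂F₁(1, b; b + 1; z)` -/

/-! Given the positions, an exponential gain of mean one averages `exp (-c * G)` to `1 / (1 + c)`,
so the Laplace transform is the mean of `∏ f (X j)`, where `f` is the `linkFactor` (equal to one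
inside the exclusion disc). The generating functional of the Poisson process
(`IsHPPP.integral_pointProd`) turns this into `exp (-lam * ∫ (1 - f))`. It is proved for step
functions from independent Poisson counts, then extended by two limits.

In polar coordinates, the substitution `v = a * d ^ (-α)` reduces the area integral to `∫ v in 0..c,
v ^ (b - 1) / (1 + v)` with `b = 1 - 2 / α`. Euler's integral identifies this with `₂F₁(1, b; b + 1;
-c)`; for `α = 4` it is `2 * arctan √c`. Almost sure convergence follows from Campbell's theorem,
since `d ^ (-α)` is integrable over the plane for `α > 2`.

For the random distance `R` to the nearest point no Palm calculus is needed. When `u ≤ t`, the event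
`u ≤ R` depends on points inside the disc of radius `t` and the interference on points outside it,
so the mean on that event factorizes (`setIntegral_exp_interference`). Rounding `R` up to a grid,
using the factorization on each cell and refining the grid inserts `R` for `t`. The limit exists
because the interference is right continuous in the radius, the cutoff `d_j > r_t` being strict. The
half-lines `u ≤ R` determine the conditional expectation. -/

/-- A geometric series in `t * z / (1 - z₀ * t)`, integrated term by term. The centre `z₀` is
arbitrary because analyticity is needed at every point below one; `z₀ = 0` gives back the Gauss
series. -/
theorem hasSum_eulerIntegral {b : ℝ} (hb : 0 < b) {z₀ z : ℝ} (h₀ : z₀ < 1)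
    (hz : |z| < 1 - z₀) :
    HasSum (fun n : ℕ => (∫ t in (0 : ℝ)..1, t ^ (b - 1) * (t ^ n / (1 - z₀ * t) ^ (n + 1))) * z ^ n)
      (∫ t in (0 : ℝ)..1, t ^ (b - 1) / (1 - (z₀ + z) * t)) := by
  have h1 : 0 < 1 - z₀ := by linarith
  set q : ℝ := |z| / (1 - z₀) with hq
  have hq0 : 0 ≤ q := by positivity
  have hq1 : q < 1 := by rw [hq, div_lt_one h1]; exact hz
  -- One bound for both signs of `z₀`: the quotient is at most `1` if `z₀ ≤ 0` and at most `1 / (1 -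
  -- z₀)` otherwise.
  set C : ℝ := 1 + 1 / (1 - z₀) with hC
  have hC0 : 0 ≤ C := by positivity
  have hden : ∀ t ∈ Ioc (0 : ℝ) 1, 0 < 1 - z₀ * t := by
    rintro t ⟨ht0, ht1⟩
    nlinarith
  have hinv : ∀ t ∈ Ioc (0 : ℝ) 1, 1 / (1 - z₀ * t) ≤ C := by
    rintro t ⟨ht0, ht1⟩
    have := hden t ⟨ht0, ht1⟩
    rcases le_total z₀ 0 with h | h
    · have : 1 / (1 - z₀ * t) ≤ 1 := by rw [div_le_one this]; nlinarith
      have : 0 ≤ 1 / (1 - z₀) := by positivity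
      linarith
    · have : 1 / (1 - z₀ * t) ≤ 1 / (1 - z₀) := one_div_le_one_div_of_le h1 (by nlinarith)
      linarith
  have hratio : ∀ t ∈ Ioc (0 : ℝ) 1, t / (1 - z₀ * t) ≤ 1 / (1 - z₀) := by
    rintro t ⟨ht0, ht1⟩
    rw [div_le_div_iff₀ (hden t ⟨ht0, ht1⟩) h1]
    nlinarith
  have hint : IntervalIntegrable (fun t : ℝ => t ^ (b - 1)) volume 0 1 :=
    intervalIntegral.intervalIntegrable_rpow' (by linarith)
  have key := intervalIntegral.hasSum_integral_of_dominated_convergence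
    (μ := volume) (a := 0) (b := 1)
    (F := fun (n : ℕ) (t : ℝ) => t ^ (b - 1) * (t ^ n / (1 - z₀ * t) ^ (n + 1)) * z ^ n)
    (f := fun t => t ^ (b - 1) / (1 - (z₀ + z) * t))
    (fun (n : ℕ) (t : ℝ) => t ^ (b - 1) * C * q ^ n) ?_ ?_ ?_ ?_ ?_
  · simpa only [intervalIntegral.integral_mul_const] using key
  · intro n
    exact (by fun_prop : Measurable _).aestronglyMeasurable
  · intro n
    refine ae_of_all _ fun t ht => ?_
    rw [uIoc_of_le zero_le_one] at ht
    have hd := hden t ht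
    have ht0 := ht.1
    have e : t ^ (b - 1) * (t ^ n / (1 - z₀ * t) ^ (n + 1)) * z ^ n
        = t ^ (b - 1) * (1 / (1 - z₀ * t)) * ((t / (1 - z₀ * t)) * z) ^ n := by
      rw [mul_pow, div_pow, pow_succ]
      field_simp
    rw [e, norm_mul, norm_pow, Real.norm_of_nonneg (by positivity)]
    have h3 : ‖t / (1 - z₀ * t) * z‖ ≤ q := by
      rw [norm_mul, Real.norm_of_nonneg (by positivity), Real.norm_eq_abs, hq,
        div_eq_mul_one_div |z|, mul_comm]
      exact mul_le_mul_of_nonneg_left (hratio t ht) (abs_nonneg z)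
    have := hinv t ht
    gcongr
  · refine ae_of_all _ fun t _ => ?_
    exact (summable_geometric_of_lt_one hq0 hq1).mul_left _
  · simp_rw [tsum_mul_left]
    exact (hint.mul_const C).mul_const _
  · refine ae_of_all _ fun t ht => ?_
    rw [uIoc_of_le zero_le_one] at ht
    have hd := hden t ht
    have ht0 := ht.1
    have h3 : ‖t / (1 - z₀ * t) * z‖ < 1 := by
      rw [norm_mul, Real.norm_of_nonneg (by positivity), Real.norm_eq_abs]
      refine lt_of_le_of_lt ?_ hq1
      rw [hq, div_eq_mul_one_div |z|, mul_comm]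
      exact mul_le_mul_of_nonneg_left (hratio t ht) (abs_nonneg z)
    have h4 := (hasSum_geometric_of_norm_lt_one h3).mul_left (t ^ (b - 1) * (1 / (1 - z₀ * t)))
    have hne : 1 - (z₀ + z) * t ≠ 0 := by
      have : t / (1 - z₀ * t) * z < 1 := lt_of_le_of_lt (le_abs_self _) h3
      rw [div_mul_eq_mul_div, div_lt_one hd] at this
      nlinarith
    have e1 : (fun n : ℕ => t ^ (b - 1) * (t ^ n / (1 - z₀ * t) ^ (n + 1)) * z ^ n) =
        fun n => t ^ (b - 1) * (1 / (1 - z₀ * t)) * (t / (1 - z₀ * t) * z) ^ n := by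
      ext n
      rw [mul_pow, div_pow, pow_succ]
      field_simp
    have e2 : t ^ (b - 1) / (1 - (z₀ + z) * t) =
        t ^ (b - 1) * (1 / (1 - z₀ * t)) * (1 - t / (1 - z₀ * t) * z)⁻¹ := by
      have : 1 - t / (1 - z₀ * t) * z = (1 - (z₀ + z) * t) / (1 - z₀ * t) := by
        rw [eq_div_iff hd.ne', sub_mul, mul_right_comm, div_mul_cancel₀ _ hd.ne']
        ring
      rw [this]
      field_simp
    rw [e1, e2]
    exact h4

/-- The rising factorial of order `n + 1` at `b` splits off either its first factor `b` or its last
factor `b + n`. -/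
theorem ascPochhammer_eval_ratio {b : ℝ} (hb : 0 < b) (n : ℕ) :
    (ascPochhammer ℝ n).eval b * ((ascPochhammer ℝ n).eval (b + 1))⁻¹ = b / (b + n) := by
  have hpos := ascPochhammer_pos n (b + 1) (by linarith)
  have h1 := ascPochhammer_succ_eval n b
  have h2 : (ascPochhammer ℝ (n + 1)).eval b = b * (ascPochhammer ℝ n).eval (b + 1) := by
    rw [ascPochhammer_succ_left]
    simp
  have : (b + n : ℝ) ≠ 0 := by positivity
  field_simp
  linarith

/-- Euler's integral is the analytic continuation of `₂F₁(1, b; b + 1; z)`. -/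
theorem isGaussContinuation_eulerIntegral {b : ℝ} (hb : 0 < b) :
    IsGaussContinuation 1 b (b + 1)
      (fun z => b * ∫ t in (0 : ℝ)..1, t ^ (b - 1) / (1 - z * t)) := by
  constructor
  · intro z₀ hz₀
    have hz₀ : z₀ < 1 := hz₀
    have : HasFPowerSeriesAt (fun z => ∫ t in (0 : ℝ)..1, t ^ (b - 1) / (1 - z * t))
        (FormalMultilinearSeries.ofScalars ℝ fun n : ℕ =>
          ∫ t in (0 : ℝ)..1, t ^ (b - 1) * (t ^ n / (1 - z₀ * t) ^ (n + 1))) z₀ := by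
      rw [hasFPowerSeriesAt_iff]
      filter_upwards [Metric.ball_mem_nhds (0 : ℝ) (sub_pos.2 hz₀)] with z hz
      have hz : |z| < 1 - z₀ := by simpa using hz
      simpa [FormalMultilinearSeries.coeff_ofScalars, mul_comm] using
        hasSum_eulerIntegral hb hz₀ hz
    exact analyticAt_const.mul this.analyticAt
  · intro z hz
    have key := (hasSum_eulerIntegral hb (z₀ := 0) (z := z) one_pos (by simpa using hz)).mul_left b
    rw [ordinaryHypergeometric_eq_tsum]
    simp only [zero_add] at key
    beta_reduce
    rw [← key.tsum_eq]
    refine tsum_congr fun n => ?_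
    have h1 : ∫ t in (0 : ℝ)..1, t ^ (b - 1) * (t ^ n / (1 - 0 * t) ^ (n + 1)) = 1 / (b + n) := by
      have : ∫ t in (0 : ℝ)..1, t ^ (b - 1) * (t ^ n / (1 - 0 * t) ^ (n + 1)) =
          ∫ t in (0 : ℝ)..1, t ^ (b - 1 + n) := by
        refine intervalIntegral.integral_congr_ae (ae_of_all _ fun t ht => ?_)
        rw [uIoc_of_le zero_le_one] at ht
        simp [Real.rpow_add ht.1]
      rw [this, integral_rpow (Or.inl _)]
      · rw [Real.one_rpow, Real.zero_rpow (by have : (0 : ℝ) ≤ n := n.cast_nonneg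
                                              linarith)]
        ring_nf
      · have : (0 : ℝ) ≤ n := n.cast_nonneg
        linarith
    rw [h1, ascPochhammer_eval_one, mul_assoc _ ((ascPochhammer ℝ n).eval b) _,
      ascPochhammer_eval_ratio hb, inv_mul_cancel₀ (by exact_mod_cast n.factorial_ne_zero),
      smul_eq_mul]
    ring

/-! ### The integral of `v ^ (b - 1) / (1 + v)` -/

/-- The incomplete integral `∫ v in 0..c, v ^ (b - 1) / (1 + v)`. -/
noncomputable def radialIntegral (b c : ℝ) : ℝ := ∫ v in (0 : ℝ)..c, v ^ (b - 1) / (1 + v)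

theorem intervalIntegrable_radial {b c : ℝ} (hb : 0 < b) (hc : 0 ≤ c) :
    IntervalIntegrable (fun v : ℝ => v ^ (b - 1) / (1 + v)) volume 0 c := by
  have hint : IntervalIntegrable (fun t : ℝ => t ^ (b - 1)) volume 0 c :=
    intervalIntegral.intervalIntegrable_rpow' (by linarith)
  refine hint.mono_fun' (by fun_prop : Measurable _).aestronglyMeasurable ?_
  rw [uIoc_of_le hc]
  filter_upwards [ae_restrict_mem measurableSet_Ioc] with t ht
  have ht0 := ht.1
  rw [Real.norm_of_nonneg (by positivity)]
  exact div_le_self (by positivity) (by linarith)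

theorem radialIntegral_zero (b : ℝ) : radialIntegral b 0 = 0 := by simp [radialIntegral]

theorem hasDerivAt_radialIntegral {b c : ℝ} (hb : 0 < b) (hc : 0 < c) :
    HasDerivAt (radialIntegral b) (c ^ (b - 1) / (1 + c)) c := by
  refine intervalIntegral.integral_hasDerivAt_right (intervalIntegrable_radial hb hc.le)
    (by fun_prop : Measurable _).stronglyMeasurable.stronglyMeasurableAtFilter ?_
  exact (Real.continuousAt_rpow_const _ _ (Or.inl hc.ne')).div (by fun_prop) (by positivity)

theorem tendsto_radialIntegral_zero {b : ℝ} (hb : 0 < b) :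
    Tendsto (radialIntegral b) (𝓝[≥] 0) (𝓝 0) := by
  have hlim : Tendsto (fun c : ℝ => c ^ b / b) (𝓝[≥] 0) (𝓝 0) := by
    have : ContinuousAt (fun c : ℝ => c ^ b / b) 0 :=
      (Real.continuousAt_rpow_const _ _ (Or.inr hb.le)).div_const b
    have := this.tendsto
    simp only [Real.zero_rpow hb.ne', zero_div] at this
    exact this.mono_left nhdsWithin_le_nhds
  refine tendsto_of_tendsto_of_tendsto_of_le_of_le' tendsto_const_nhds hlim ?_ ?_
  · filter_upwards [self_mem_nhdsWithin] with c hc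
    refine intervalIntegral.integral_nonneg hc fun v hv => ?_
    have := hv.1
    positivity
  · filter_upwards [self_mem_nhdsWithin] with c hc
    have h1 : ∫ v in (0 : ℝ)..c, v ^ (b - 1) = c ^ b / b := by
      rw [integral_rpow (Or.inl (by linarith))]
      simp [Real.zero_rpow hb.ne']
    rw [← h1]
    refine intervalIntegral.integral_mono_on hc (intervalIntegrable_radial hb hc)
      (intervalIntegral.intervalIntegrable_rpow' (by linarith)) fun v hv => ?_
    have := hv.1
    exact div_le_self (by positivity) (by linarith)

/-- The substitution `v = c * t` in Euler's integral. -/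
theorem rpow_mul_gauss2F1_neg {b c : ℝ} (hb : 0 < b) (hc : 0 < c) :
    c ^ b * gauss2F1 1 b (b + 1) (-c) = b * radialIntegral b c := by
  rw [gauss2F1_eq (isGaussContinuation_eulerIntegral hb) (by linarith), radialIntegral]
  have h := intervalIntegral.smul_integral_comp_mul_left (a := 0) (b := 1)
    (fun v : ℝ => v ^ (b - 1) / (1 + v)) c
  simp only [mul_zero, mul_one, smul_eq_mul] at h
  have h2 : ∫ t in (0 : ℝ)..1, (c * t) ^ (b - 1) / (1 + c * t) =
      c ^ (b - 1) * ∫ t in (0 : ℝ)..1, t ^ (b - 1) / (1 - -c * t) := by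
    rw [← intervalIntegral.integral_const_mul]
    refine intervalIntegral.integral_congr_ae (ae_of_all _ fun t ht => ?_)
    rw [uIoc_of_le zero_le_one] at ht
    rw [Real.mul_rpow hc.le ht.1.le, mul_div_assoc]
    simp
  rw [← h, h2]
  have : c ^ b = c * c ^ (b - 1) := by
    rw [← Real.rpow_one_add' hc.le (by simpa using hb.ne')]
    ring_nf
  rw [this]
  ring

/-- `2 * arctan √v` is an antiderivative on the open interval only, as `√` is not differentiable at
zero; continuity at the endpoints suffices. -/
theorem radialIntegral_half {c : ℝ} (hc : 0 ≤ c) :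
    radialIntegral (1 / 2) c = 2 * Real.arctan √c := by
  have h := intervalIntegral.integral_eq_sub_of_hasDerivAt_of_le hc
    (f := fun v => 2 * Real.arctan √v) (f' := fun v => v ^ ((1 / 2 : ℝ) - 1) / (1 + v))
    (by fun_prop) ?_ (intervalIntegrable_radial (by norm_num) hc)
  · rw [radialIntegral, h]
    simp
  · intro v hv
    have hv0 := hv.1
    have := ((Real.hasDerivAt_sqrt hv0.ne').arctan).const_mul 2
    have e : v ^ ((1 / 2 : ℝ) - 1) / (1 + v) = 2 * (1 / (1 + √v ^ 2) * (1 / (2 * √v))) := by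
      rw [Real.sq_sqrt hv0.le, show (1 / 2 : ℝ) - 1 = -(1 / 2) by norm_num, Real.rpow_neg hv0.le,
        ← Real.sqrt_eq_rpow]
      field_simp
    rw [e]
    exact this

/-! ### Path loss and the area integral -/

theorem linkDist_pos {h : ℝ} (hh : 0 < h) (r : ℝ) : 0 < linkDist h r :=
  Real.sqrt_pos.2 (by positivity)

theorem linkDist_rpow {h : ℝ} (r x : ℝ) :
    linkDist h r ^ x = (h ^ 2 + r ^ 2) ^ (x / 2) := by
  rw [linkDist, Real.sqrt_eq_rpow, ← Real.rpow_mul (by positivity)]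
  ring_nf

theorem linkDist_lt_linkDist {h r ρ : ℝ} (hr : 0 ≤ r) (hρ : 0 ≤ ρ) :
    linkDist h r < linkDist h ρ ↔ r < ρ := by
  rw [linkDist, linkDist, Real.sqrt_lt_sqrt_iff (by positivity), add_lt_add_iff_left,
    sq_lt_sq₀ hr hρ]

theorem continuous_linkDist (h : ℝ) : Continuous (linkDist h) := by
  unfold linkDist
  fun_prop

theorem continuous_linkDist_rpow {h : ℝ} (hh : 0 < h) (x : ℝ) :
    Continuous fun r => linkDist h r ^ x :=
  (continuous_linkDist h).rpow_const fun r => Or.inl (linkDist_pos hh r).ne'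

/-- The Laplace factor of a single Rayleigh-faded link at horizontal distance `ρ`, for the serving
distance `r` and the scaled Laplace variable `a`. -/
noncomputable def linkFactor (α h a r ρ : ℝ) : ℝ :=
  if linkDist h r < linkDist h ρ then 1 / (1 + a * linkDist h ρ ^ (-α)) else 1

theorem linkFactor_nonneg {α h a r ρ : ℝ} (hh : 0 < h) (ha : 0 ≤ a) :
    0 ≤ linkFactor α h a r ρ := by
  have := linkDist_pos hh ρ
  rw [linkFactor]
  split_ifs <;> positivity

theorem linkFactor_le_one {α h a r ρ : ℝ} (hh : 0 < h) (ha : 0 ≤ a) :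
    linkFactor α h a r ρ ≤ 1 := by
  have := linkDist_pos hh ρ
  rw [linkFactor]
  split_ifs
  · rw [div_le_one (by positivity)]
    have : 0 ≤ a * linkDist h ρ ^ (-α) := by positivity
    linarith
  · exact le_rfl

theorem measurable_linkFactor {α h a r : ℝ} (hh : 0 < h) : Measurable (linkFactor α h a r) := by
  have h1 := (continuous_linkDist h).measurable
  have h2 := (continuous_linkDist_rpow hh (-α)).measurable
  exact Measurable.ite (measurableSet_lt measurable_const h1) (by fun_prop) measurable_const

/-- With `v = a * d ^ (-α)` and `b - 1 = -2 / α`, one has `v ^ (b - 1) = a ^ (-2 / α) * d ^ 2` and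
`dv = -α * v * ρ / d ^ 2 dρ`. The powers of `d` cancel, and the prefactor leaves `-ρ * v / (1 + v)`.
-/
theorem hasDerivAt_radialIntegral_linkDist {α h a : ℝ} (hα : 2 < α) (hh : 0 < h) (ha : 0 < a)
    (ρ : ℝ) :
    HasDerivAt (fun ρ => a ^ (2 / α) / α * radialIntegral (1 - 2 / α) (a * linkDist h ρ ^ (-α)))
      (-(ρ * (1 - 1 / (1 + a * linkDist h ρ ^ (-α))))) ρ := by
  have hb : 0 < 1 - 2 / α := by rw [sub_pos, div_lt_one (by linarith)]; exact hα
  have hα0 : 0 < α := by linarith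
  simp only [linkDist_rpow]
  set w : ℝ := h ^ 2 + ρ ^ 2 with hw
  have hw0 : 0 < w := by positivity
  have hy : 0 < a * w ^ (-α / 2) := by positivity
  have d1 : HasDerivAt (fun ρ : ℝ => h ^ 2 + ρ ^ 2) (2 * ρ) ρ := by
    simpa using (hasDerivAt_pow 2 ρ).const_add (h ^ 2)
  have d2 := (d1.rpow_const (p := -α / 2) (Or.inl hw0.ne')).const_mul a
  have d3 := ((hasDerivAt_radialIntegral hb hy).comp ρ d2).const_mul (a ^ (2 / α) / α)
  rw [← hw] at d3
  refine d3.congr_deriv ?_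
  have e1 : (a * w ^ (-α / 2)) ^ (1 - 2 / α - 1) = (a ^ (2 / α))⁻¹ * w := by
    rw [show 1 - 2 / α - 1 = -(2 / α) by ring, Real.mul_rpow ha.le (by positivity),
      Real.rpow_neg ha.le, ← Real.rpow_mul hw0.le]
    congr 1
    rw [show -α / 2 * -(2 / α) = 1 by field_simp, Real.rpow_one]
  have e2 : w ^ (-α / 2 - 1) = w ^ (-α / 2) / w := Real.rpow_sub_one hw0.ne' _
  rw [e1, e2]
  have : 0 < a ^ (2 / α) := by positivity
  have : 0 < w ^ (-α / 2) := by positivity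
  field_simp
  ring

theorem tendsto_radialIntegral_linkDist {α h a : ℝ} (hα : 2 < α) (ha : 0 ≤ a) :
    Tendsto (fun ρ => a ^ (2 / α) / α * radialIntegral (1 - 2 / α) (a * linkDist h ρ ^ (-α)))
      atTop (𝓝 0) := by
  have hb : 0 < 1 - 2 / α := by rw [sub_pos, div_lt_one (by linarith)]; exact hα
  have h1 : Tendsto (fun ρ => linkDist h ρ) atTop atTop := by
    refine tendsto_atTop_mono (f := fun ρ => ρ) (fun ρ => ?_) tendsto_id
    exact Real.le_sqrt_of_sq_le (by nlinarith [sq_nonneg h])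
  have h2 := ((tendsto_rpow_neg_atTop (by linarith : 0 < α)).comp h1).const_mul a
  rw [mul_zero] at h2
  have h3 : Tendsto (fun ρ => a * linkDist h ρ ^ (-α)) atTop (𝓝[≥] 0) :=
    tendsto_nhdsWithin_iff.2 ⟨h2, Eventually.of_forall fun ρ => mem_Ici.2 <|
      mul_nonneg ha (Real.rpow_nonneg (Real.sqrt_nonneg _) _)⟩
  simpa using ((tendsto_radialIntegral_zero hb).comp h3).const_mul (a ^ (2 / α) / α)

/-- The antiderivative vanishes at infinity, so the integral is its value at `r`; the constant sign
of the derivative yields integrability as well. -/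
theorem integral_one_sub_linkFactor_aux {α h a r : ℝ} (hα : 2 < α) (hh : 0 < h) (ha : 0 < a)
    (hr : 0 ≤ r) :
    IntegrableOn (fun ρ => ρ * (1 - linkFactor α h a r ρ)) (Ioi 0) ∧
      ∫ ρ in Ioi 0, ρ * (1 - linkFactor α h a r ρ) =
        a ^ (2 / α) / α * radialIntegral (1 - 2 / α) (a * linkDist h r ^ (-α)) := by
  have hd : ∀ ρ ∈ Ici r, HasDerivAt _ _ ρ :=
    fun ρ _ => hasDerivAt_radialIntegral_linkDist hα hh ha ρ
  have hneg : ∀ ρ ∈ Ioi r, -(ρ * (1 - 1 / (1 + a * linkDist h ρ ^ (-α)))) ≤ 0 := by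
    intro ρ hρ
    have hρ : r < ρ := hρ
    have := linkDist_pos hh ρ
    have h1 : 1 / (1 + a * linkDist h ρ ^ (-α)) ≤ 1 := by
      rw [div_le_one (by positivity)]
      have : 0 ≤ a * linkDist h ρ ^ (-α) := by positivity
      linarith
    have : 0 ≤ ρ * (1 - 1 / (1 + a * linkDist h ρ ^ (-α))) :=
      mul_nonneg (by linarith) (by linarith)
    linarith
  have hlim := tendsto_radialIntegral_linkDist (h := h) hα ha.le
  have i1 := integrableOn_Ioi_deriv_of_nonpos' hd hneg hlim
  have i2 := integral_Ioi_of_hasDerivAt_of_nonpos' hd hneg hlim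
  have e : EqOn (fun ρ => ρ * (1 - linkFactor α h a r ρ))
      ((Ioi r).indicator fun ρ => ρ * (1 - 1 / (1 + a * linkDist h ρ ^ (-α)))) (Ioi 0) := by
    intro ρ hρ
    by_cases hρr : r < ρ
    · have := (linkDist_lt_linkDist (h := h) hr (le_of_lt hρ)).2 hρr
      simp [linkFactor, hρr, this]
    · have := mt (linkDist_lt_linkDist (h := h) hr (le_of_lt hρ)).1 hρr
      simp [linkFactor, hρr, this]
  have hsub : Ioi 0 ∩ Ioi r = Ioi r := inter_eq_right.2 (Ioi_subset_Ioi hr)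
  constructor
  · rw [integrableOn_congr_fun e measurableSet_Ioi, integrableOn_indicator_iff measurableSet_Ioi,
      inter_comm, hsub]
    simpa using i1.neg
  · rw [setIntegral_congr_fun measurableSet_Ioi e, setIntegral_indicator measurableSet_Ioi, hsub]
    rw [integral_neg] at i2
    linarith

theorem measureReal_unitBall_plane : (volume : Measure Plane).real (Metric.ball 0 1) = Real.pi := by
  rw [Measure.real, InnerProductSpace.volume_ball_of_dim_even (k := 1) (by simp)]
  simp [Real.pi_pos.le]

theorem integral_one_sub_linkFactor {α h a r : ℝ} (hα : 2 < α) (hh : 0 < h) (ha : 0 ≤ a)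
    (hr : 0 ≤ r) :
    Integrable (fun x : Plane => 1 - linkFactor α h a r ‖x‖) ∧
      ∫ x : Plane, (1 - linkFactor α h a r ‖x‖) =
        2 * Real.pi / α * a ^ (2 / α) *
          radialIntegral (1 - 2 / α) (a * linkDist h r ^ (-α)) := by
  rcases ha.eq_or_lt with rfl | ha
  · simp [linkFactor, radialIntegral_zero]
  · obtain ⟨h1, h2⟩ := integral_one_sub_linkFactor_aux hα hh ha hr
    constructor
    · rw [integrable_fun_norm_addHaar volume (f := fun ρ => 1 - linkFactor α h a r ρ)]
      simpa using h1
    · rw [integral_fun_norm_addHaar volume (fun ρ => 1 - linkFactor α h a r ρ),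
        measureReal_unitBall_plane]
      simp only [finrank_euclideanSpace, Fintype.card_fin, smul_eq_mul, nsmul_eq_mul,
        Nat.add_one_sub_one, pow_one]
      rw [h2]
      push_cast
      ring

/-- Scaling by `h` reduces to `(1 + ‖x‖ ^ 2) ^ (-α / 2)`, integrable in dimension two because `α >
2`. -/
theorem integrable_linkDist_rpow {α h : ℝ} (hα : 2 < α) (hh : 0 < h) :
    Integrable fun x : Plane => linkDist h ‖x‖ ^ (-α) := by
  have h1 : Integrable (fun x : Plane => ((1 : ℝ) + ‖x‖ ^ 2) ^ (-α / 2)) :=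
    integrable_rpow_neg_one_add_norm_sq (by simpa using hα)
  have h2 : Integrable (fun x : Plane => ((1 : ℝ) + ‖h⁻¹ • x‖ ^ 2) ^ (-α / 2)) :=
    h1.comp_smul (inv_ne_zero hh.ne')
  refine (h2.const_mul (h ^ (-α))).congr (ae_of_all _ fun x => ?_)
  beta_reduce
  rw [linkDist_rpow, norm_smul, norm_inv, Real.norm_of_nonneg hh.le]
  have : h ^ 2 + ‖x‖ ^ 2 = h ^ 2 * (1 + (h⁻¹ * ‖x‖) ^ 2) := by
    field_simp
  rw [this, Real.mul_rpow (by positivity) (by positivity), ← Real.rpow_natCast h,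
    ← Real.rpow_mul hh.le]
  congr 2
  push_cast
  ring

/-- The exponent of the interference Laplace transform, divided by `-lam`. -/
noncomputable def effectiveArea (α h a r : ℝ) : ℝ :=
  2 * Real.pi / α * a ^ (2 / α) * radialIntegral (1 - 2 / α) (a * linkDist h r ^ (-α))

theorem continuous_effectiveArea {α h a : ℝ} (hα : 2 < α) (hh : 0 < h) (ha : 0 ≤ a) :
    Continuous (effectiveArea α h a) := by
  have hα0 : 0 < α := by linarith
  rcases ha.eq_or_lt with rfl | ha
  · have : (0 : ℝ) ^ (2 / α) = 0 := Real.zero_rpow (by positivity)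
    refine (continuous_const (y := (0 : ℝ))).congr fun ρ => ?_
    simp [effectiveArea, this]
  · have h1 : Continuous fun ρ =>
        a ^ (2 / α) / α * radialIntegral (1 - 2 / α) (a * linkDist h ρ ^ (-α)) :=
      continuous_iff_continuousAt.2 fun ρ =>
        (hasDerivAt_radialIntegral_linkDist hα hh ha ρ).continuousAt
    refine (h1.const_mul (2 * Real.pi)).congr fun ρ => ?_
    rw [effectiveArea]
    ring

theorem effectiveArea_eq_gauss2F1 {α h a : ℝ} (hα : 2 < α) (hh : 0 < h) (ha : 0 ≤ a) (r : ℝ) :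
    effectiveArea α h a r = 2 * Real.pi * a * linkDist h r ^ (2 - α) / (α * (1 - 2 / α)) *
      gauss2F1 1 (1 - 2 / α) (2 - 2 / α) (-(a * linkDist h r ^ (-α))) := by
  have hα0 : 0 < α := by linarith
  have hb : 0 < 1 - 2 / α := by rw [sub_pos, div_lt_one (by linarith)]; exact hα
  rcases ha.eq_or_lt with rfl | ha
  · simp [effectiveArea, radialIntegral_zero]
  · have hd := linkDist_pos hh r
    have hc : 0 < a * linkDist h r ^ (-α) := by positivity
    have key := rpow_mul_gauss2F1_neg hb hc
    rw [show 1 - 2 / α + 1 = 2 - 2 / α by ring] at key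
    -- Splitting `a` into `a ^ (2 / α) * a ^ (1 - 2 / α)` produces the power `c ^ b` of the Euler
    -- identity.
    have e : a * linkDist h r ^ (2 - α) =
        a ^ (2 / α) * (a * linkDist h r ^ (-α)) ^ (1 - 2 / α) := by
      rw [Real.mul_rpow ha.le (by positivity), ← mul_assoc, ← Real.rpow_add ha,
        ← Real.rpow_mul hd.le]
      congr 1
      · ring_nf
        simp
      · congr 1
        field_simp
        ring
    rw [effectiveArea, mul_assoc (2 * Real.pi) a, e]
    generalize gauss2F1 1 (1 - 2 / α) (2 - 2 / α) (-(a * linkDist h r ^ (-α))) = F at *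
    generalize radialIntegral (1 - 2 / α) (a * linkDist h r ^ (-α)) = J at *
    generalize (a * linkDist h r ^ (-α)) ^ (1 - 2 / α) = C at *
    generalize 1 - 2 / α = b at *
    have hJ : J = C * F / b := by
      rw [key, mul_div_cancel_left₀ _ hb.ne']
    rw [hJ]
    field_simp

theorem effectiveArea_four {h a : ℝ} (hh : 0 < h) (ha : 0 ≤ a) (r : ℝ) :
    effectiveArea 4 h a r = Real.pi * √a * Real.arctan (√a / linkDist h r ^ 2) := by
  have hd := linkDist_pos hh r
  have e : √(a * linkDist h r ^ (-4 : ℝ)) = √a / linkDist h r ^ 2 := by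
    have : linkDist h r ^ (-4 : ℝ) = ((linkDist h r ^ 2)⁻¹) ^ 2 := by
      rw [Real.rpow_neg hd.le, show (4 : ℝ) = ((4 : ℕ) : ℝ) by norm_num, Real.rpow_natCast]
      rw [inv_pow, ← pow_mul]
    rw [this, Real.sqrt_mul ha, Real.sqrt_sq (by positivity), div_eq_mul_inv]
  rw [effectiveArea, show (1 : ℝ) - 2 / 4 = 1 / 2 by norm_num, radialIntegral_half (by positivity),
    e, show (2 : ℝ) / 4 = 1 / 2 by norm_num, ← Real.sqrt_eq_rpow]
  ring

/-! ### Poisson laws -/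

theorem lintegral_natCast_poissonMeasure (r : ℝ≥0) :
    ∫⁻ k, (k : ℝ≥0∞) ∂poissonMeasure r = r := by
  have h1 : HasSum (fun n : ℕ => (r : ℝ) ^ n / n.factorial) (Real.exp r) := by
    rw [Real.exp_eq_exp_ℝ]
    exact NormedSpace.expSeries_div_hasSum_exp (r : ℝ)
  rw [poissonMeasure, lintegral_sum_measure]
  simp only [lintegral_smul_measure, lintegral_dirac, smul_eq_mul]
  rw [tsum_eq_zero_add' ENNReal.summable]
  have h2 : ∀ n : ℕ, ENNReal.ofReal (Real.exp (-r) * r ^ (n + 1) / (n + 1).factorial) *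
      ((n + 1 : ℕ) : ℝ≥0∞) = ENNReal.ofReal (Real.exp (-r) * r * (r ^ n / n.factorial)) := by
    intro n
    rw [← ENNReal.ofReal_natCast, ← ENNReal.ofReal_mul (by positivity), Nat.factorial_succ]
    congr 1
    push_cast
    field_simp
    ring
  simp only [h2, Nat.cast_zero, mul_zero, zero_add]
  rw [← ENNReal.ofReal_tsum_of_nonneg (fun n => by positivity) (h1.summable.mul_left _),
    tsum_mul_left, h1.tsum_eq, mul_right_comm, ← Real.exp_add]
  simp

theorem integral_pow_poissonMeasure (r : ℝ≥0) (a : ℝ) :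
    ∫ k, a ^ k ∂poissonMeasure r = Real.exp (-(r * (1 - a))) := by
  have h1 : HasSum (fun n : ℕ => (r * a : ℝ) ^ n / n.factorial) (Real.exp (r * a)) := by
    rw [Real.exp_eq_exp_ℝ]
    exact NormedSpace.expSeries_div_hasSum_exp (r * a : ℝ)
  rw [integral_poissonMeasure]
  have h2 : ∀ n : ℕ, (Real.exp (-r) * r ^ n / n.factorial) • a ^ n =
      Real.exp (-r) * ((r * a : ℝ) ^ n / n.factorial) := by
    intro n
    rw [smul_eq_mul, mul_pow]
    ring
  rw [tsum_congr h2, tsum_mul_left, h1.tsum_eq, ← Real.exp_add]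
  ring_nf

/-! ### Products over a sequence of points -/

/-- The product of `g` over the points of the configuration `x`, for `0 ≤ g ≤ 1`. -/
noncomputable def pointProd {E : Type*} (g : E → ℝ) (x : ℕ → E) : ℝ :=
  ⨅ n : ℕ, ∏ j ∈ Finset.range n, g (x j)

section pointProd

variable {E : Type*} {g : E → ℝ} {x : ℕ → E}

theorem prod_range_mem_Icc (h0 : ∀ y, 0 ≤ g y) (h1 : ∀ y, g y ≤ 1) (n : ℕ) :
    ∏ j ∈ Finset.range n, g (x j) ∈ Icc (0 : ℝ) 1 :=
  ⟨Finset.prod_nonneg fun _ _ => h0 _, Finset.prod_le_one (fun _ _ => h0 _) fun _ _ => h1 _⟩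

theorem bddBelow_range_pointProd (h0 : ∀ y, 0 ≤ g y) :
    BddBelow (range fun n : ℕ => ∏ j ∈ Finset.range n, g (x j)) :=
  ⟨0, by rintro _ ⟨n, rfl⟩; exact Finset.prod_nonneg fun _ _ => h0 _⟩

theorem tendsto_pointProd (h0 : ∀ y, 0 ≤ g y) (h1 : ∀ y, g y ≤ 1) :
    Tendsto (fun n : ℕ => ∏ j ∈ Finset.range n, g (x j)) atTop (𝓝 (pointProd g x)) := by
  refine tendsto_atTop_ciInf (antitone_nat_of_succ_le fun n => ?_) (bddBelow_range_pointProd h0)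
  rw [Finset.prod_range_succ]
  exact mul_le_of_le_one_right (prod_range_mem_Icc h0 h1 n).1 (h1 _)

theorem pointProd_mem_Icc (h0 : ∀ y, 0 ≤ g y) (h1 : ∀ y, g y ≤ 1) :
    pointProd g x ∈ Icc (0 : ℝ) 1 :=
  isClosed_Icc.mem_of_tendsto (tendsto_pointProd h0 h1)
    (Eventually.of_forall (prod_range_mem_Icc h0 h1))

/-- The partial products are constant once the range contains `S`. -/
theorem pointProd_eq_prod (h0 : ∀ y, 0 ≤ g y) (h1 : ∀ y, g y ≤ 1) {S : Finset ℕ}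
    (hS : ∀ n, n ∉ S → g (x n) = 1) : pointProd g x = ∏ j ∈ S, g (x j) := by
  refine tendsto_nhds_unique (tendsto_pointProd h0 h1) (tendsto_const_nhds.congr' ?_)
  obtain ⟨N, hN⟩ := S.bddAbove
  filter_upwards [eventually_gt_atTop N] with n hn
  refine Finset.prod_subset (fun j hj => Finset.mem_range.2 ((hN hj).trans_lt hn)) ?_
  intro j _ hj
  exact hS j hj

theorem measurable_pointProd [MeasurableSpace E] {Ω : Type*} [MeasurableSpace Ω] {X : ℕ → Ω → E}
    (hX : ∀ n, Measurable (X n)) (hg : Measurable g) :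
    Measurable fun ω => pointProd g fun n => X n ω :=
  Measurable.iInf fun _ => Finset.measurable_prod _ fun j _ => hg.comp (hX j)

end pointProd

/-! ### The generating functional of a homogeneous Poisson point process -/

theorem integrable_of_mem_Icc {Ω : Type*} [MeasurableSpace Ω] {μ : Measure Ω} [IsFiniteMeasure μ]
    {f : Ω → ℝ} (hf : AEStronglyMeasurable f μ) (h : ∀ᵐ ω ∂μ, f ω ∈ Icc (0 : ℝ) 1) :
    Integrable f μ :=
  Integrable.of_bound hf 1 <| h.mono fun ω hω => by
    rw [Real.norm_of_nonneg hω.1]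
    exact hω.2

theorem tendsto_integral_of_mem_Icc {Ω : Type*} [MeasurableSpace Ω] {μ : Measure Ω}
    [IsFiniteMeasure μ] {F : ℕ → Ω → ℝ} {f : Ω → ℝ} (hF : ∀ n, AEStronglyMeasurable (F n) μ)
    (h : ∀ n, ∀ᵐ ω ∂μ, F n ω ∈ Icc (0 : ℝ) 1)
    (hlim : ∀ᵐ ω ∂μ, Tendsto (fun n => F n ω) atTop (𝓝 (f ω))) :
    Tendsto (fun n => ∫ ω, F n ω ∂μ) atTop (𝓝 (∫ ω, f ω ∂μ)) :=
  tendsto_integral_of_dominated_convergence (fun _ => 1) hF (integrable_const 1)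
    (fun n => (h n).mono fun ω hω => by
      rw [Real.norm_of_nonneg hω.1]
      exact hω.2) hlim

namespace IsHPPP

variable {Ω : Type*} [MeasurableSpace Ω] {μ : Measure Ω} {X : ℕ → Ω → Plane} {lam : ℝ}

theorem ae_finite (hX : IsHPPP μ X lam) {B : Set Plane} (hB : MeasurableSet B)
    (hb : Bornology.IsBounded B) : ∀ᵐ ω ∂μ, {n | X n ω ∈ B}.Finite := by
  have h := hX.poisson B hB hb
  have h1 : ∀ᵐ ω ∂μ, pointCount (fun n => X n ω) B ≠ ⊤ := by
    rw [ae_iff]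
    simp only [ne_eq, not_not]
    rw [h.measure_eq (p := fun k => k = ⊤) (MeasurableSet.of_discrete),
      Measure.map_apply .of_discrete .of_discrete]
    have : (fun k : ℕ => (k : ℕ∞)) ⁻¹' {k | k = ⊤} = ∅ := by
      ext k
      simp
    rw [this, measure_empty]
  filter_upwards [h1] with ω hω
  exact Set.encard_ne_top_iff.1 hω

/-- By Tonelli the left side is the expected number of points in `B`, the mean of a Poisson law. -/
theorem sum_map_apply (hX : IsHPPP μ X lam) (hlam : 0 ≤ lam) {B : Set Plane}
    (hB : MeasurableSet B) (hb : Bornology.IsBounded B) :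
    Measure.sum (fun n => μ.map (X n)) B = ENNReal.ofReal lam * volume B := by
  have h := hX.poisson B hB hb
  rw [Measure.sum_apply _ hB]
  have h1 : ∀ n, μ.map (X n) B = ∫⁻ ω, B.indicator 1 (X n ω) ∂μ := fun n => by
    rw [Measure.map_apply (hX.measurable n) hB, ← lintegral_indicator_one (hX.measurable n hB)]
    rfl
  simp only [h1]
  have hm : ∀ n, AEMeasurable (fun ω => B.indicator (1 : Plane → ℝ≥0∞) (X n ω)) μ := fun n =>
    ((measurable_one.indicator hB).comp (hX.measurable n)).aemeasurable
  rw [← lintegral_tsum hm]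
  have h2 : ∀ ω, ∑' n, B.indicator (1 : Plane → ℝ≥0∞) (X n ω) =
      ((pointCount (fun n => X n ω) B : ℕ∞) : ℝ≥0∞) := by
    intro ω
    rw [pointCount, ← ENNReal.tsum_set_one, tsum_subtype {n | X n ω ∈ B} fun _ => (1 : ℝ≥0∞)]
    rfl
  simp only [h2]
  rw [h.lintegral_comp (f := fun k : ℕ∞ => (k : ℝ≥0∞)) Measurable.of_discrete.aemeasurable,
    lintegral_map .of_discrete .of_discrete]
  simp only [ENat.toENNReal_coe]
  rw [lintegral_natCast_poissonMeasure]
  change ENNReal.ofReal _ = _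
  rw [ENNReal.ofReal_mul hlam, ENNReal.ofReal_toReal hb.measure_lt_top.ne]

/-- Campbell's theorem: the intensity measure of the process is `lam` times area. -/
theorem sum_map (hX : IsHPPP μ X lam) (hlam : 0 ≤ lam) :
    Measure.sum (fun n => μ.map (X n)) = ENNReal.ofReal lam • volume := by
  ext A hA
  -- The counts are prescribed on bounded sets only, hence the exhaustion by balls.
  have hU : A = ⋃ n : ℕ, A ∩ Metric.ball 0 n := by
    rw [← inter_iUnion, Metric.iUnion_ball_nat, inter_univ]
  have hmono : Monotone fun n : ℕ => A ∩ Metric.ball (0 : Plane) n := fun m n hmn =>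
    inter_subset_inter_right _ (Metric.ball_subset_ball (by exact_mod_cast hmn))
  rw [hU, hmono.measure_iUnion, hmono.measure_iUnion]
  refine iSup_congr fun n => ?_
  rw [hX.sum_map_apply hlam (hA.inter measurableSet_ball)
    (Metric.isBounded_ball.subset inter_subset_right)]
  rfl

theorem tsum_lintegral (hX : IsHPPP μ X lam) (hlam : 0 ≤ lam) {f : Plane → ℝ≥0∞}
    (hf : Measurable f) :
    ∑' n, ∫⁻ ω, f (X n ω) ∂μ = ENNReal.ofReal lam * ∫⁻ x, f x := by
  have h : ∀ n, ∫⁻ ω, f (X n ω) ∂μ = ∫⁻ x, f x ∂μ.map (X n) := fun n =>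
    (lintegral_map hf (hX.measurable n)).symm
  simp only [h]
  rw [← lintegral_sum_measure, hX.sum_map hlam, lintegral_smul_measure, smul_eq_mul]

theorem integral_pow_pointCount (hX : IsHPPP μ X lam) (hlam : 0 ≤ lam) {B : Set Plane}
    (hB : MeasurableSet B) (hb : Bornology.IsBounded B) (a : ℝ) :
    ∫ ω, a ^ (pointCount (fun n => X n ω) B).toNat ∂μ =
      Real.exp (-(lam * volume.real B * (1 - a))) := by
  have h := hX.poisson B hB hb
  rw [← integral_map (f := fun k : ℕ∞ => a ^ k.toNat) h.aemeasurable
    Measurable.of_discrete.aestronglyMeasurable, h.map_eq,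
    integral_map .of_discrete Measurable.of_discrete.aestronglyMeasurable]
  simp only [ENat.toNat_natCast]
  rw [integral_pow_poissonMeasure, Real.coe_toNNReal _ (by positivity)]
  rfl

/-- The generating functional at a step function. -/
theorem integral_pointProd_step (hX : IsHPPP μ X lam) (hlam : 0 ≤ lam) {B : Set Plane}
    (hB : MeasurableSet B) (hb : Bornology.IsBounded B) {k : ℕ} {i : Plane → Fin k}
    (hi : Measurable i) {a : Fin k → ℝ} (h0 : ∀ l, 0 ≤ a l) (h1 : ∀ l, a l ≤ 1)
    [DecidablePred (· ∈ B)] :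
    ∫ ω, pointProd (fun y => if y ∈ B then a (i y) else 1) (fun n => X n ω) ∂μ =
      Real.exp (-(lam * ∫ y, (1 - if y ∈ B then a (i y) else 1))) := by
  set C : Fin k → Set Plane := fun l => B ∩ i ⁻¹' {l} with hC
  have hCm : ∀ l, MeasurableSet (C l) := fun l => hB.inter (hi (measurableSet_singleton l))
  have hCb : ∀ l, Bornology.IsBounded (C l) := fun l => hb.subset inter_subset_left
  have hCd : Pairwise fun l l' => Disjoint (C l) (C l') := by
    intro l l' hll
    rw [Set.disjoint_left]
    rintro y ⟨_, hy⟩ ⟨_, hy'⟩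
    exact hll (hy.symm.trans hy')
  -- Grouping the finitely many points of `B` by the cell containing them leaves powers of
  -- independent Poisson counts.
  have e1 : ∀ᵐ ω ∂μ, pointProd (fun y => if y ∈ B then a (i y) else 1) (fun n => X n ω) =
      ∏ l, a l ^ (pointCount (fun n => X n ω) (C l)).toNat := by
    filter_upwards [hX.ae_finite hB hb] with ω hω
    rw [pointProd_eq_prod (S := hω.toFinset)]
    · rw [Finset.prod_congr rfl (g := fun j => a (i (X j ω)))]
      · rw [← Finset.prod_fiberwise' hω.toFinset (fun j => i (X j ω)) a]
        refine Finset.prod_congr rfl fun l _ => ?_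
        rw [Finset.prod_const]
        congr 1
        have : {n | X n ω ∈ C l} =
            ((hω.toFinset.filter fun j => i (X j ω) = l : Finset ℕ) : Set ℕ) := by
          ext j
          simp [hC]
        rw [pointCount, this, Set.encard_coe_eq_coe_finsetCard, ENat.toNat_natCast]
      · intro j hj
        have : X j ω ∈ B := by simpa using hj
        simp [this]
    · intro y
      split_ifs
      exacts [h0 _, zero_le_one]
    · intro y
      split_ifs
      exacts [h1 _, le_rfl]
    · intro n hn
      have : X n ω ∉ B := by simpa using hn
      simp [this]
  have e2 : ∀ y, (1 - if y ∈ B then a (i y) else 1) =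
      ∑ l, (C l).indicator (fun _ => 1 - a l) y := by
    intro y
    by_cases hy : y ∈ B
    · rw [Finset.sum_eq_single (i y)]
      · simp [hC, hy]
      · intro l _ hl
        simp [hC, hl.symm]
      · simp
    · simp [hC, hy]
  rw [integral_congr_ae e1]
  have h := (hX.indep k C hCm hCb hCd).integral_fun_prod_comp
    (f := fun l (m : ℕ∞) => a l ^ m.toNat)
    (fun l => (hX.poisson (C l) (hCm l) (hCb l)).aemeasurable)
    (fun l => Measurable.of_discrete.aestronglyMeasurable)
  rw [h]
  simp only [e2]
  rw [integral_finsetSum _ fun l _ => (integrable_indicator_iff (hCm l)).2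
    (integrableOn_const (hCb l).measure_lt_top.ne), Finset.mul_sum, ← Finset.sum_neg_distrib,
    Real.exp_sum]
  refine Finset.prod_congr rfl fun l _ => ?_
  rw [hX.integral_pow_pointCount hlam (hCm l) (hCb l), integral_indicator_const _ (hCm l),
    smul_eq_mul, mul_assoc]

/-- The generating functional at a function equal to one outside a bounded set. -/
theorem integral_pointProd_of_bounded [IsFiniteMeasure μ] (hX : IsHPPP μ X lam) (hlam : 0 ≤ lam)
    {B : Set Plane} (hB : MeasurableSet B) (hb : Bornology.IsBounded B) {g : Plane → ℝ}
    (hg : Measurable g) (h0 : ∀ y, 0 ≤ g y) (h1 : ∀ y, g y ≤ 1) (hgB : ∀ y, y ∉ B → g y = 1) :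
    ∫ ω, pointProd g (fun n => X n ω) ∂μ = Real.exp (-(lam * ∫ y, (1 - g y))) := by
  classical
  -- Rounds `g` down to a multiple of `1 / (m + 1)`. The minimum only serves the type `Fin (m + 2)`;
  -- since `g ≤ 1` it is never active.
  set i : (m : ℕ) → Plane → Fin (m + 2) := fun m y =>
    ⟨min ⌊g y * ((m : ℝ) + 1)⌋₊ (m + 1), by omega⟩ with hi
  have him : ∀ m, Measurable (i m) := fun m =>
    (Measurable.of_discrete (f := fun k : ℕ => (⟨min k (m + 1), by omega⟩ : Fin (m + 2)))).comp
      (Nat.measurable_floor.comp (hg.mul_const _))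
  set a : (m : ℕ) → Fin (m + 2) → ℝ := fun m l => (l : ℝ) / ((m : ℝ) + 1) with ha
  have ha0 : ∀ m l, 0 ≤ a m l := fun m l => by positivity
  have ha1 : ∀ m l, a m l ≤ 1 := fun m l => by
    rw [ha, div_le_one (by positivity)]
    exact_mod_cast Nat.lt_succ_iff.1 l.2
  set G : ℕ → Plane → ℝ := fun m y => if y ∈ B then a m (i m y) else 1 with hG
  have hGm : ∀ m, Measurable (G m) := fun m =>
    Measurable.ite hB ((Measurable.of_discrete (f := a m)).comp (him m)) measurable_const
  have hG0 : ∀ m y, 0 ≤ G m y := fun m y => by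
    simp only [hG]
    split_ifs
    exacts [ha0 _ _, zero_le_one]
  have hG1 : ∀ m y, G m y ≤ 1 := fun m y => by
    simp only [hG]
    split_ifs
    exacts [ha1 _ _, le_rfl]
  have hlim : ∀ y, Tendsto (fun m => G m y) atTop (𝓝 (g y)) := by
    intro y
    by_cases hy : y ∈ B
    · have h2 := (tendsto_nat_floor_mul_div_atTop (h0 y)).comp
        (tendsto_atTop_add_const_right atTop (1 : ℝ) tendsto_natCast_atTop_atTop)
      refine h2.congr fun m => ?_
      have h3 : ⌊g y * ((m : ℝ) + 1)⌋₊ ≤ m + 1 := by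
        refine Nat.floor_le_of_le ?_
        push_cast
        exact mul_le_of_le_one_left (by positivity) (h1 y)
      simp only [hG, hy, if_true, ha, hi, min_eq_left h3, Function.comp_apply]
    · simp [hG, hy, hgB y hy]
  have hstep : ∀ m, ∫ ω, pointProd (G m) (fun n => X n ω) ∂μ =
      Real.exp (-(lam * ∫ y, (1 - G m y))) := fun m =>
    hX.integral_pointProd_step hlam hB hb (him m) (ha0 m) (ha1 m)
  have hL : Tendsto (fun m => ∫ ω, pointProd (G m) (fun n => X n ω) ∂μ) atTop
      (𝓝 (∫ ω, pointProd g (fun n => X n ω) ∂μ)) := by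
    refine tendsto_integral_of_mem_Icc
      (fun m => (measurable_pointProd hX.measurable (hGm m)).aestronglyMeasurable)
      (fun m => ae_of_all _ fun ω => pointProd_mem_Icc (hG0 m) (hG1 m)) ?_
    filter_upwards [hX.ae_finite hB hb] with ω hω
    have e1 : ∀ n, n ∉ hω.toFinset → X n ω ∉ B := fun n hn => by simpa using hn
    rw [pointProd_eq_prod h0 h1 (S := hω.toFinset) fun n hn => hgB _ (e1 n hn)]
    have e2 : ∀ m, pointProd (G m) (fun n => X n ω) = ∏ j ∈ hω.toFinset, G m (X j ω) := fun m =>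
      pointProd_eq_prod (hG0 m) (hG1 m) fun n hn => by simp [hG, e1 n hn]
    simp only [e2]
    exact tendsto_finsetProd _ fun j _ => hlim _
  have hR : Tendsto (fun m => ∫ y, (1 - G m y)) atTop (𝓝 (∫ y, (1 - g y))) := by
    refine tendsto_integral_of_dominated_convergence (B.indicator fun _ => 1)
      (fun m => (measurable_const.sub (hGm m)).aestronglyMeasurable)
      ((integrable_indicator_iff hB).2 (integrableOn_const hb.measure_lt_top.ne))
      (fun m => ae_of_all _ fun y => ?_) (ae_of_all _ fun y => (hlim y).const_sub 1)
    by_cases hy : y ∈ B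
    · rw [indicator_of_mem hy, Real.norm_of_nonneg (by linarith [hG1 m y])]
      linarith [hG0 m y]
    · simp [hG, hy]
  refine tendsto_nhds_unique hL ?_
  simp only [hstep]
  exact (Real.continuous_exp.tendsto _).comp ((hR.const_mul lam).neg)

/-- The generating functional of a homogeneous Poisson point process. -/
theorem integral_pointProd [IsFiniteMeasure μ] (hX : IsHPPP μ X lam) (hlam : 0 ≤ lam)
    {g : Plane → ℝ} (hg : Measurable g) (h0 : ∀ y, 0 ≤ g y) (h1 : ∀ y, g y ≤ 1)
    (hgi : Integrable fun y => 1 - g y) :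
    ∫ ω, pointProd g (fun n => X n ω) ∂μ = Real.exp (-(lam * ∫ y, (1 - g y))) := by
  classical
  set G : ℕ → Plane → ℝ := fun m y => if y ∈ Metric.ball (0 : Plane) m then g y else 1 with hG
  have hGm : ∀ m, Measurable (G m) := fun m =>
    Measurable.ite measurableSet_ball hg measurable_const
  have hG0 : ∀ m y, 0 ≤ G m y := fun m y => by
    simp only [hG]
    split_ifs
    exacts [h0 _, zero_le_one]
  have hG1 : ∀ m y, G m y ≤ 1 := fun m y => by
    simp only [hG]
    split_ifs
    exacts [h1 _, le_rfl]
  have hgG : ∀ m y, g y ≤ G m y := fun m y => by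
    simp only [hG]
    split_ifs
    exacts [le_rfl, h1 _]
  have hev : ∀ y, ∀ᶠ m : ℕ in atTop, G m y = g y := by
    intro y
    filter_upwards [eventually_gt_atTop ⌈‖y‖⌉₊] with m hm
    have : y ∈ Metric.ball (0 : Plane) m := by
      rw [mem_ball_zero_iff]
      exact (Nat.le_ceil _).trans_lt (by exact_mod_cast hm)
    simp only [hG, if_pos this]
  have hL : Tendsto (fun m => ∫ ω, pointProd (G m) (fun n => X n ω) ∂μ) atTop
      (𝓝 (∫ ω, pointProd g (fun n => X n ω) ∂μ)) := by
    refine tendsto_integral_of_mem_Icc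
      (fun m => (measurable_pointProd hX.measurable (hGm m)).aestronglyMeasurable)
      (fun m => ae_of_all _ fun ω => pointProd_mem_Icc (hG0 m) (hG1 m))
      (ae_of_all _ fun ω => ?_)
    -- Truncation only raises the product, which gives the lower bound. For the upper bound, a
    -- finite partial product already lies below `c`, and the truncation eventually leaves its
    -- factors unchanged.
    refine tendsto_order.2 ⟨fun c hc => Eventually.of_forall fun m => hc.trans_le ?_,
      fun c hc => ?_⟩
    · exact ciInf_mono (bddBelow_range_pointProd h0) fun n =>
        Finset.prod_le_prod (fun _ _ => h0 _) fun _ _ => hgG _ _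
    · obtain ⟨n, hn⟩ := exists_lt_of_ciInf_lt hc
      have h2 : ∀ᶠ m : ℕ in atTop, ∀ j ∈ Finset.range n, G m (X j ω) = g (X j ω) :=
        (eventually_all_finset _).2 fun j _ => hev _
      filter_upwards [h2] with m hm
      refine (ciInf_le (bddBelow_range_pointProd (hG0 m)) n).trans_lt ?_
      rwa [Finset.prod_congr rfl hm]
  have hR : Tendsto (fun m => ∫ y, (1 - G m y)) atTop (𝓝 (∫ y, (1 - g y))) := by
    refine tendsto_integral_of_dominated_convergence (fun y => 1 - g y)
      (fun m => (measurable_const.sub (hGm m)).aestronglyMeasurable) hgi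
      (fun m => ae_of_all _ fun y => ?_) (ae_of_all _ fun y => ?_)
    · rw [Real.norm_of_nonneg (by linarith [hG1 m y])]
      linarith [hgG m y]
    · exact tendsto_const_nhds.congr' ((hev y).mono fun m hm => by simp only [hm])
  have hstep : ∀ m, ∫ ω, pointProd (G m) (fun n => X n ω) ∂μ =
      Real.exp (-(lam * ∫ y, (1 - G m y))) := fun m =>
    hX.integral_pointProd_of_bounded hlam (B := Metric.ball 0 m) measurableSet_ball
      Metric.isBounded_ball (hGm m) (hG0 m) (hG1 m) fun y hy => by simp only [hG, if_neg hy]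
  refine tendsto_nhds_unique hL ?_
  simp only [hstep]
  exact (Real.continuous_exp.tendsto _).comp ((hR.const_mul lam).neg)

end IsHPPP

/-! ### Rayleigh fading -/

theorem nakagamiPowerLaw_one :
    nakagamiPowerLaw 1 =
      (volume.restrict (Ioi 0)).withDensity fun x : ℝ => ENNReal.ofReal (Real.exp (-x)) := by
  have h : gammaPDF 1 1 = (Ici (0 : ℝ)).indicator fun x => ENNReal.ofReal (Real.exp (-x)) := by
    ext x
    by_cases hx : 0 ≤ x
    · rw [gammaPDF_of_nonneg hx, indicator_of_mem (mem_Ici.2 hx)]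
      simp
    · rw [gammaPDF_of_neg (not_le.1 hx), indicator_of_notMem (by simpa using hx)]
  rw [nakagamiPowerLaw, gammaMeasure, h, withDensity_indicator measurableSet_Ici,
    Measure.restrict_congr_set Ioi_ae_eq_Ici]

theorem ae_nonneg_nakagamiPowerLaw_one : ∀ᵐ x ∂nakagamiPowerLaw 1, 0 ≤ x := by
  rw [nakagamiPowerLaw_one]
  refine (withDensity_absolutelyContinuous _ _).ae_le ?_
  filter_upwards [ae_restrict_mem measurableSet_Ioi] with x hx using le_of_lt hx

theorem integral_exp_neg_mul_nakagamiPowerLaw_one {a : ℝ} (ha : 0 ≤ a) :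
    ∫ x, Real.exp (-(a * x)) ∂nakagamiPowerLaw 1 = 1 / (1 + a) := by
  rw [nakagamiPowerLaw_one, integral_withDensity_eq_integral_toReal_smul (by fun_prop) (by simp)]
  have h : ∀ x : ℝ, (ENNReal.ofReal (Real.exp (-x))).toReal • Real.exp (-(a * x)) =
      Real.exp (-(1 + a) * x) := by
    intro x
    rw [ENNReal.toReal_ofReal (Real.exp_pos _).le, smul_eq_mul, ← Real.exp_add]
    ring_nf
  simp only [h]
  rw [integral_exp_mul_Ioi (by linarith), mul_zero, Real.exp_zero, neg_div_neg_eq]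

theorem lintegral_nakagamiPowerLaw_one_ne_top :
    ∫⁻ x, ENNReal.ofReal x ∂nakagamiPowerLaw 1 ≠ ⊤ := by
  rw [nakagamiPowerLaw_one, lintegral_withDensity_eq_lintegral_mul _ (by fun_prop) (by fun_prop)]
  have h : IntegrableOn (fun x : ℝ => Real.exp (-x) * x) (Ioi 0) := by
    have := Real.GammaIntegral_convergent (s := 2) (by norm_num)
    norm_num at this
    exact this
  have h2 := h.lintegral_lt_top
  refine ne_of_lt (lt_of_eq_of_lt (lintegral_congr fun x => ?_) h2)
  rw [Pi.mul_apply, ENNReal.ofReal_mul (Real.exp_pos _).le]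

namespace IsUAVNetwork

variable {Ω : Type*} [MeasurableSpace Ω] {μ : Measure Ω} {X : ℕ → Ω → Plane} {G : ℕ → Ω → ℝ}
  {lam : ℝ}

theorem ae_gain_nonneg (hnet : IsUAVNetwork μ X G lam 1) : ∀ᵐ ω ∂μ, ∀ j, 0 ≤ G j ω :=
  ae_all_iff.2 fun j => ((hnet.gain_law j).ae_iff (p := fun x => 0 ≤ x)
    (measurableSet_Ici.mem)).2 ae_nonneg_nakagamiPowerLaw_one

/-- By independence and Campbell's theorem the expectation of the sum is the mean gain times `lam *
∫ f`, which is finite. -/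
theorem ae_summable [IsProbabilityMeasure μ] (hnet : IsUAVNetwork μ X G lam 1) (hlam : 0 ≤ lam)
    {f : Plane → ℝ} (hf : Measurable f) (hf0 : ∀ x, 0 ≤ f x) (hfi : Integrable f) :
    ∀ᵐ ω ∂μ, Summable fun j => G j ω * f (X j ω) := by
  have hX := hnet.hppp
  have h1 : ∀ j, ∫⁻ ω, ENNReal.ofReal (G j ω * f (X j ω)) ∂μ =
      (∫⁻ x, ENNReal.ofReal x ∂nakagamiPowerLaw 1) * ∫⁻ ω, ENNReal.ofReal (f (X j ω)) ∂μ := by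
    intro j
    have hind : IndepFun (fun ω => ENNReal.ofReal (G j ω)) (fun ω => ENNReal.ofReal (f (X j ω))) μ :=
      hnet.gain_indep_positions.symm.comp
        (φ := fun g : ℕ → ℝ => ENNReal.ofReal (g j))
        (ψ := fun x : ℕ → Plane => ENNReal.ofReal (f (x j)))
        (ENNReal.measurable_ofReal.comp (measurable_pi_apply j))
        (ENNReal.measurable_ofReal.comp (hf.comp (measurable_pi_apply j)))
    simp only [fun ω => ENNReal.ofReal_mul' (p := G j ω) (hf0 (X j ω))]
    have hfm : Measurable fun ω => ENNReal.ofReal (f (X j ω)) :=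
      (hf.comp (hX.measurable j)).ennreal_ofReal
    rw [lintegral_mul_eq_lintegral_mul_lintegral_of_indepFun''
      (hnet.gain_measurable j).ennreal_ofReal.aemeasurable hfm.aemeasurable hind,
      ← (hnet.gain_law j).lintegral_comp (f := fun x => ENNReal.ofReal x) (by fun_prop)]
  have h2 : ∑' j, ∫⁻ ω, ENNReal.ofReal (G j ω * f (X j ω)) ∂μ ≠ ⊤ := by
    simp only [h1]
    rw [ENNReal.tsum_mul_left, hX.tsum_lintegral hlam hf.ennreal_ofReal]
    exact ENNReal.mul_ne_top lintegral_nakagamiPowerLaw_one_ne_top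
      (ENNReal.mul_ne_top ENNReal.ofReal_ne_top hfi.lintegral_lt_top.ne)
  have hm : ∀ j, AEMeasurable (fun ω => ENNReal.ofReal (G j ω * f (X j ω))) μ := fun j =>
    ((hnet.gain_measurable j).mul (hf.comp (hX.measurable j))).ennreal_ofReal.aemeasurable
  rw [← lintegral_tsum hm] at h2
  filter_upwards [ae_lt_top' (AEMeasurable.tsum hm) h2, hnet.ae_gain_nonneg] with ω hω h0
  refine (ENNReal.summable_toReal hω.ne).congr fun j => ?_
  exact ENNReal.toReal_ofReal (mul_nonneg (h0 j) (hf0 _))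

/-- Averaging over the fading, for finitely many links. -/
theorem integral_prod_mul_exp [IsProbabilityMeasure μ] (hnet : IsUAVNetwork μ X G lam 1)
    {v c : Plane → ℝ} (hv : Measurable v) (hv0 : ∀ x, 0 ≤ v x) (hv1 : ∀ x, v x ≤ 1)
    (hc : Measurable c) (hc0 : ∀ x, 0 ≤ c x) (n : ℕ) :
    ∫ ω, ∏ j ∈ Finset.range n, (v (X j ω) * Real.exp (-(c (X j ω) * G j ω))) ∂μ =
      ∫ ω, ∏ j ∈ Finset.range n, (v (X j ω) * (1 / (1 + c (X j ω)))) ∂μ := by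
  have hX := hnet.hppp.measurable
  have hG := hnet.gain_measurable
  have hXp : Measurable fun ω j => X j ω := measurable_pi_lambda _ hX
  have hGp : Measurable fun ω j => G j ω := measurable_pi_lambda _ hG
  simp only [Finset.prod_range]
  set F : (ℕ → Plane) × (ℕ → ℝ) → ℝ := fun p =>
    ∏ j : Fin n, (v (p.1 j) * Real.exp (-(c (p.1 j) * p.2 j))) with hF
  have hFm : Measurable F := by
    refine Finset.measurable_prod _ fun j _ => ?_
    have h1 : Measurable fun p : (ℕ → Plane) × (ℕ → ℝ) => p.1 j :=
      (measurable_pi_apply _).comp measurable_fst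
    have h2 : Measurable fun p : (ℕ → Plane) × (ℕ → ℝ) => p.2 j :=
      (measurable_pi_apply _).comp measurable_snd
    exact (hv.comp h1).mul ((hc.comp h1).mul h2).neg.exp
  -- Independence makes the joint law of positions and gains a product, so Fubini allows the gains
  -- to be integrated with the positions frozen.
  have hmap := (indepFun_iff_map_prod_eq_prod_map_map hXp.aemeasurable hGp.aemeasurable).1
    hnet.gain_indep_positions
  have hFi : Integrable F (μ.map fun ω => (fun j => X j ω, fun j => G j ω)) := by
    rw [integrable_map_measure hFm.aestronglyMeasurable (hXp.prodMk hGp).aemeasurable]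
    refine integrable_of_mem_Icc (hFm.comp (hXp.prodMk hGp)).aestronglyMeasurable ?_
    filter_upwards [hnet.ae_gain_nonneg] with ω h0
    have h2 : ∀ j, 0 ≤ v (X j ω) * Real.exp (-(c (X j ω) * G j ω)) := fun j =>
      mul_nonneg (hv0 _) (Real.exp_pos _).le
    refine ⟨Finset.prod_nonneg fun j _ => h2 j, Finset.prod_le_one (fun j _ => h2 j) fun j _ => ?_⟩
    refine mul_le_one₀ (hv1 _) (Real.exp_pos _).le (Real.exp_le_one_iff.2 ?_)
    exact neg_nonpos.2 (mul_nonneg (hc0 _) (h0 _))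
  have e1 : ∫ ω, F (fun j => X j ω, fun j => G j ω) ∂μ =
      ∫ p, F p ∂μ.map fun ω => (fun j => X j ω, fun j => G j ω) :=
    (integral_map (hXp.prodMk hGp).aemeasurable hFm.aestronglyMeasurable).symm
  have e2 : ∀ x : ℕ → Plane, ∫ g, F (x, g) ∂μ.map (fun ω j => G j ω) =
      ∏ j : Fin n, (v (x j) * (1 / (1 + c (x j)))) := by
    intro x
    have hFx : Measurable fun g => F (x, g) := hFm.comp measurable_prodMk_left
    rw [integral_map hGp.aemeasurable hFx.aestronglyMeasurable]
    simp only [hF, Finset.prod_mul_distrib]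
    rw [integral_const_mul]
    congr 1
    have hind : iIndepFun (fun (j : Fin n) ω => G j ω) μ :=
      hnet.gain_indep.precomp Fin.val_injective
    refine (iIndepFun.integral_fun_prod_comp (X := fun (j : Fin n) ω => G j ω)
      (f := fun j y => Real.exp (-(c (x j) * y))) hind
      (fun j => (hG _).aemeasurable) fun j => by fun_prop).trans ?_
    refine Finset.prod_congr rfl fun j _ => ?_
    rw [← integral_exp_neg_mul_nakagamiPowerLaw_one (hc0 _), ← (hnet.gain_law j).map_eq,
      integral_map (hG _).aemeasurable (by fun_prop)]
  calc _ = ∫ ω, F (fun j => X j ω, fun j => G j ω) ∂μ := rfl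
    _ = ∫ x, ∏ j : Fin n, (v (x j) * (1 / (1 + c (x j)))) ∂μ.map (fun ω j => X j ω) := by
      rw [e1, hmap, integral_prod _ (hmap ▸ hFi)]
      simp only [e2]
    _ = _ := by
      rw [integral_map hXp.aemeasurable]
      refine (Finset.measurable_prod _ fun j _ => ?_).aestronglyMeasurable
      have h1 : Measurable fun x : ℕ → Plane => x j := measurable_pi_apply _
      exact (hv.comp h1).mul (((hc.comp h1).const_add 1).const_div 1)

end IsUAVNetwork

/-! ### The nearest point and the interference -/

theorem le_nearestDist_iff {x : ℕ → Plane} {u : ℝ} : u ≤ nearestDist x ↔ ∀ j, u ≤ ‖x j‖ :=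
  le_ciInf_iff ⟨0, by rintro _ ⟨j, rfl⟩; exact norm_nonneg _⟩

theorem nearestDist_nonneg (x : ℕ → Plane) : 0 ≤ nearestDist x :=
  le_nearestDist_iff.2 fun _ => norm_nonneg _

/-- Makes the event of an empty disc an instance of the generating functional. -/
theorem pointProd_indicator_norm_ge (x : ℕ → Plane) (u : ℝ) :
    pointProd ({y : Plane | u ≤ ‖y‖}.indicator 1) x = if u ≤ nearestDist x then 1 else 0 := by
  have h0 : ∀ y, 0 ≤ {y : Plane | u ≤ ‖y‖}.indicator (1 : Plane → ℝ) y :=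
    indicator_nonneg fun _ _ => zero_le_one
  have h1 : ∀ y, {y : Plane | u ≤ ‖y‖}.indicator (1 : Plane → ℝ) y ≤ 1 :=
    fun y => indicator_le_self' (fun _ _ => zero_le_one) y
  split_ifs with h
  · rw [le_nearestDist_iff] at h
    rw [pointProd_eq_prod h0 h1 (S := ∅) fun n _ => ?_, Finset.prod_empty]
    exact indicator_of_mem (s := {y : Plane | u ≤ ‖y‖}) (h n) _
  · rw [le_nearestDist_iff] at h
    push Not at h
    obtain ⟨j, hj⟩ := h
    refine le_antisymm ((ciInf_le (bddBelow_range_pointProd h0) (j + 1)).trans_eq ?_)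
      (pointProd_mem_Icc h0 h1).1
    exact Finset.prod_eq_zero (Finset.self_mem_range_succ j)
      (indicator_of_notMem (by simpa using hj) _)

theorem measurable_nearestDist {Ω : Type*} [MeasurableSpace Ω] {X : ℕ → Ω → Plane}
    (hX : ∀ n, Measurable (X n)) : Measurable fun ω => nearestDist fun j => X j ω :=
  Measurable.iInf fun j => (hX j).norm

theorem measurable_interferenceTerm {Ω : Type*} [MeasurableSpace Ω] {X : ℕ → Ω → Plane}
    {G : ℕ → Ω → ℝ} {h : ℝ} (hh : 0 < h) (hX : ∀ n, Measurable (X n)) (hG : ∀ n, Measurable (G n))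
    (P α : ℝ) {ρ : Ω → ℝ} (hρ : Measurable ρ) (j : ℕ) :
    Measurable fun ω => interferenceTerm P α h (ρ ω) (fun j => X j ω) (fun j => G j ω) j := by
  have hd := (continuous_linkDist h).measurable
  have h1 : Measurable fun ω => linkDist h ‖X j ω‖ := hd.comp (hX j).norm
  have h2 : Measurable fun ω => linkDist h ‖X j ω‖ ^ (-α) :=
    (continuous_linkDist_rpow hh (-α)).measurable.comp (hX j).norm
  exact Measurable.ite (measurableSet_lt (hd.comp hρ) h1) (((hG j).mul_const P).mul h2)
    measurable_const

/-- For every `r` the terms restrict one sequence that does not involve `r`, so a single null set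
serves all radii, random ones included. -/
theorem interferenceTerm_eq_indicator (P α h r : ℝ) (x : ℕ → Plane) (g : ℕ → ℝ) :
    interferenceTerm P α h r x g = {j | linkDist h r < linkDist h ‖x j‖}.indicator
      fun j => P * (g j * linkDist h ‖x j‖ ^ (-α)) := by
  ext j
  rw [interferenceTerm, indicator_apply]
  refine if_congr Iff.rfl ?_ rfl
  ring

section Interference

variable {P α h : ℝ} {x : ℕ → Plane} {g : ℕ → ℝ}

theorem summable_interferenceTerm (hs : Summable fun j => g j * linkDist h ‖x j‖ ^ (-α)) (r : ℝ) :
    Summable (interferenceTerm P α h r x g) := by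
  rw [interferenceTerm_eq_indicator]
  exact (hs.mul_left P).indicator _

theorem interferenceTerm_nonneg (hP : 0 ≤ P) (hg : ∀ j, 0 ≤ g j) (r : ℝ) (j : ℕ) :
    0 ≤ interferenceTerm P α h r x g j := by
  rw [interferenceTerm]
  have : 0 ≤ linkDist h ‖x j‖ := Real.sqrt_nonneg _
  have := hg j
  split_ifs <;> positivity

theorem exp_neg_interference_mem_Icc (hP : 0 ≤ P) (hg : ∀ j, 0 ≤ g j) {s : ℝ} (hs : 0 ≤ s)
    (r : ℝ) : Real.exp (-s * interference P α h r x g) ∈ Icc (0 : ℝ) 1 := by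
  refine ⟨(Real.exp_pos _).le, Real.exp_le_one_iff.2 ?_⟩
  have : 0 ≤ interference P α h r x g := tsum_nonneg (interferenceTerm_nonneg hP hg r)
  nlinarith

/-- Points beyond `r` are eventually beyond `ρ n`, and points within `r` stay excluded because `r ≤
ρ n`; the unrestricted series dominates. -/
theorem tendsto_interference (hP : 0 ≤ P) (hg : ∀ j, 0 ≤ g j)
    (hs : Summable fun j => g j * linkDist h ‖x j‖ ^ (-α)) {r : ℝ} (hr : 0 ≤ r) {ρ : ℕ → ℝ}
    (hρ : ∀ n, r ≤ ρ n) (hlim : Tendsto ρ atTop (𝓝 r)) :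
    Tendsto (fun n => interference P α h (ρ n) x g) atTop (𝓝 (interference P α h r x g)) := by
  refine tendsto_tsum_of_dominated_convergence (hs.mul_left P) (fun j => ?_)
    (Eventually.of_forall fun n j => ?_)
  · refine tendsto_const_nhds.congr' ?_
    unfold interferenceTerm
    rcases lt_or_ge r ‖x j‖ with hj | hj
    · filter_upwards [hlim.eventually_lt_const hj] with n hn
      rw [if_pos ((linkDist_lt_linkDist hr (norm_nonneg _)).2 hj),
        if_pos ((linkDist_lt_linkDist (hr.trans (hρ n)) (norm_nonneg _)).2 hn)]
    · refine Eventually.of_forall fun n => ?_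
      beta_reduce
      rw [if_neg (mt (linkDist_lt_linkDist hr (norm_nonneg _)).1 hj.not_gt),
        if_neg (mt (linkDist_lt_linkDist (hr.trans (hρ n)) (norm_nonneg _)).1
          (hj.trans (hρ n)).not_gt)]
  · rw [interferenceTerm_eq_indicator]
    have h0 : 0 ≤ P * (g j * linkDist h ‖x j‖ ^ (-α)) :=
      mul_nonneg hP (mul_nonneg (hg j) (Real.rpow_nonneg (Real.sqrt_nonneg _) _))
    refine (norm_indicator_le_norm_self _ _).trans ?_
    rw [Real.norm_of_nonneg h0]

end Interference

/-! ### The Laplace transform on the event of an empty disc -/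

namespace IsUAVNetwork

variable {Ω : Type*} [MeasurableSpace Ω] {μ : Measure Ω} [IsProbabilityMeasure μ]
  {X : ℕ → Ω → Plane} {G : ℕ → Ω → ℝ} {lam P α h : ℝ}

theorem ae_summable_linkDist (hnet : IsUAVNetwork μ X G lam 1) (hlam : 0 ≤ lam) (hα : 2 < α)
    (hh : 0 < h) : ∀ᵐ ω ∂μ, Summable fun j => G j ω * linkDist h ‖X j ω‖ ^ (-α) :=
  hnet.ae_summable (f := fun x => linkDist h ‖x‖ ^ (-α)) hlam
    ((continuous_linkDist_rpow hh (-α)).measurable.comp measurable_norm)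
    (fun _ => Real.rpow_nonneg (Real.sqrt_nonneg _) _) (integrable_linkDist_rpow hα hh)

theorem aestronglyMeasurable_exp_interference (hnet : IsUAVNetwork μ X G lam 1) (hlam : 0 ≤ lam)
    (hα : 2 < α) (hh : 0 < h) (s : ℝ) {ρ : Ω → ℝ} (hρ : Measurable ρ) :
    AEStronglyMeasurable (fun ω => Real.exp
      (-s * interference P α h (ρ ω) (fun j => X j ω) (fun j => G j ω))) μ := by
  have hm : AEStronglyMeasurable
      (fun ω => interference P α h (ρ ω) (fun j => X j ω) (fun j => G j ω)) μ := by
    refine aestronglyMeasurable_of_tendsto_ae atTop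
      (f := fun n ω => ∑ j ∈ Finset.range n,
        interferenceTerm P α h (ρ ω) (fun j => X j ω) (fun j => G j ω) j) (fun n => ?_) ?_
    · exact (Finset.measurable_sum _ fun j _ => measurable_interferenceTerm hh
        hnet.hppp.measurable hnet.gain_measurable P α hρ j).aestronglyMeasurable
    · filter_upwards [hnet.ae_summable_linkDist hlam hα hh] with ω hω
      exact (summable_interferenceTerm hω _).hasSum.tendsto_sum_nat
  exact Real.continuous_exp.comp_aestronglyMeasurable (hm.const_mul (-s))

/-- The Laplace transform of the interference from outside the disc of radius `t`, on the event that
there is no point closer than `u ≤ t`. -/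
theorem setIntegral_exp_interference (hnet : IsUAVNetwork μ X G lam 1) (hlam : 0 ≤ lam)
    (hα : 2 < α) (hh : 0 < h) (hP : 0 ≤ P) {s : ℝ} (hs : 0 ≤ s) {u t : ℝ} (ht : 0 ≤ t)
    (hut : u ≤ t) :
    ∫ ω in {ω | u ≤ nearestDist fun j => X j ω},
        Real.exp (-s * interference P α h t (fun j => X j ω) (fun j => G j ω)) ∂μ =
      Real.exp (-(lam * effectiveArea α h (s * P) t)) *
        μ.real {ω | u ≤ nearestDist fun j => X j ω} := by
  have hX := hnet.hppp
  have hsP : 0 ≤ s * P := mul_nonneg hs hP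
  have hR := measurable_nearestDist hX.measurable
  have hA : MeasurableSet {ω | u ≤ nearestDist fun j => X j ω} :=
    measurableSet_le measurable_const hR
  set v : Plane → ℝ := {y : Plane | u ≤ ‖y‖}.indicator 1 with hv
  have hvm : Measurable v :=
    measurable_one.indicator (measurableSet_le measurable_const measurable_norm)
  have hv0 : ∀ y, 0 ≤ v y := indicator_nonneg fun _ _ => zero_le_one
  have hv1 : ∀ y, v y ≤ 1 := fun y => indicator_le_self' (fun _ _ => zero_le_one) y
  have hvi : Integrable fun y => 1 - v y := by
    have : (fun y => 1 - v y) = (Metric.ball (0 : Plane) u).indicator fun _ => 1 := by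
      ext y
      rcases le_or_gt u ‖y‖ with hy | hy
      · simp [hv, hy]
      · simp [hv, hy, hy.not_ge]
    rw [this]
    exact (integrable_indicator_iff measurableSet_ball).2
      (integrableOn_const measure_ball_lt_top.ne)
  set c : Plane → ℝ := fun y =>
    if linkDist h t < linkDist h ‖y‖ then s * P * linkDist h ‖y‖ ^ (-α) else 0 with hc
  have hcm : Measurable c := Measurable.ite
    (measurableSet_lt measurable_const ((continuous_linkDist h).measurable.comp measurable_norm))
    (((continuous_linkDist_rpow hh (-α)).measurable.comp measurable_norm).const_mul _)
    measurable_const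
  have hc0 : ∀ y, 0 ≤ c y := fun y => by
    have := linkDist_pos hh ‖y‖
    simp only [hc]
    split_ifs <;> positivity
  have hcf : ∀ y, 1 / (1 + c y) = linkFactor α h (s * P) t ‖y‖ := fun y => by
    simp only [hc, linkFactor]
    split_ifs <;> simp
  obtain ⟨hfi, hfa⟩ := integral_one_sub_linkFactor hα hh hsP ht
  set f : Plane → ℝ := fun y => linkFactor α h (s * P) t ‖y‖ with hf
  have hfm : Measurable f := (measurable_linkFactor hh).comp measurable_norm
  have hf0 : ∀ y, 0 ≤ f y := fun y => linkFactor_nonneg hh hsP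
  have hf1 : ∀ y, f y ≤ 1 := fun y => linkFactor_le_one hh hsP
  have hg0 : ∀ y, 0 ≤ v y * f y := fun y => mul_nonneg (hv0 y) (hf0 y)
  have hg1 : ∀ y, v y * f y ≤ 1 := fun y => mul_le_one₀ (hv1 y) (hf0 y) (hf1 y)
  -- Where `v` vanishes, `‖y‖ < u ≤ t` and so `f = 1`. This additivity becomes the factorization of
  -- the generating functional.
  have hsplit : ∀ y, 1 - v y * f y = (1 - v y) + (1 - f y) := by
    intro y
    by_cases hy : u ≤ ‖y‖
    · simp [hv, hy]
    · have : ¬ t < ‖y‖ := by linarith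
      have := mt (linkDist_lt_linkDist (h := h) ht (norm_nonneg y)).1 this
      simp [hv, hf, hy, linkFactor, this]
  have hgm : Measurable fun y => v y * f y := hvm.mul hfm
  have hgi : Integrable fun y => 1 - v y * f y := by
    simp only [hsplit]
    exact hvi.add hfi
  have hpg : ∫ ω, pointProd (fun y => v y * f y) (fun n => X n ω) ∂μ =
      Real.exp (-(lam * effectiveArea α h (s * P) t)) *
        μ.real {ω | u ≤ nearestDist fun j => X j ω} := by
    rw [hX.integral_pointProd hlam hgm hg0 hg1 hgi]
    simp only [hsplit]
    rw [integral_add hvi hfi, hfa, mul_add, neg_add, Real.exp_add, mul_comm]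
    congr 1
    rw [← hX.integral_pointProd hlam hvm hv0 hv1 hvi, ← integral_indicator_one hA]
    refine integral_congr_ae (ae_of_all _ fun ω => ?_)
    beta_reduce
    rw [hv, pointProd_indicator_norm_ge, indicator_apply]
    rfl
  have hR' : Tendsto (fun n => ∫ ω, ∏ j ∈ Finset.range n, (v (X j ω) * f (X j ω)) ∂μ) atTop
      (𝓝 (∫ ω, pointProd (fun y => v y * f y) (fun n => X n ω) ∂μ)) := by
    refine tendsto_integral_of_mem_Icc (fun n => ?_)
      (fun n => ae_of_all _ fun ω => prod_range_mem_Icc hg0 hg1 n)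
      (ae_of_all _ fun ω => tendsto_pointProd hg0 hg1)
    exact (Finset.measurable_prod _ fun j _ =>
      hgm.comp (hX.measurable j)).aestronglyMeasurable
  have hL : Tendsto (fun n => ∫ ω, ∏ j ∈ Finset.range n,
        (v (X j ω) * Real.exp (-(c (X j ω) * G j ω))) ∂μ) atTop
      (𝓝 (∫ ω, {ω | u ≤ nearestDist fun j => X j ω}.indicator (fun ω =>
        Real.exp (-s * interference P α h t (fun j => X j ω) (fun j => G j ω))) ω ∂μ)) := by
    refine tendsto_integral_of_mem_Icc (fun n => ?_) (fun n => ?_) ?_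
    · exact (Finset.measurable_prod _ fun j _ => (hvm.comp (hX.measurable j)).mul
        ((hcm.comp (hX.measurable j)).mul (hnet.gain_measurable j)).neg.exp).aestronglyMeasurable
    · filter_upwards [hnet.ae_gain_nonneg] with ω h0
      have h2 : ∀ j, 0 ≤ v (X j ω) * Real.exp (-(c (X j ω) * G j ω)) := fun j =>
        mul_nonneg (hv0 _) (Real.exp_pos _).le
      refine ⟨Finset.prod_nonneg fun j _ => h2 j,
        Finset.prod_le_one (fun j _ => h2 j) fun j _ => ?_⟩
      refine mul_le_one₀ (hv1 _) (Real.exp_pos _).le (Real.exp_le_one_iff.2 ?_)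
      exact neg_nonpos.2 (mul_nonneg (hc0 _) (h0 _))
    · filter_upwards [hnet.ae_summable_linkDist hlam hα hh] with ω hω
      have t1 := tendsto_pointProd (x := fun j => X j ω) hv0 hv1
      have t2 := ((summable_interferenceTerm (P := P) hω t).hasSum.tendsto_sum_nat).const_mul (-s)
      have t3 := t1.mul ((Real.continuous_exp.tendsto _).comp t2)
      have e : {ω | u ≤ nearestDist fun j => X j ω}.indicator (fun ω =>
          Real.exp (-s * interference P α h t (fun j => X j ω) (fun j => G j ω))) ω =
          pointProd v (fun j => X j ω) * Real.exp (-s * ∑' j,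
            interferenceTerm P α h t (fun j => X j ω) (fun j => G j ω) j) := by
        rw [hv, pointProd_indicator_norm_ge, indicator_apply]
        by_cases hu : u ≤ nearestDist fun j => X j ω <;> simp [hu, interference]
      rw [e]
      refine t3.congr fun n => ?_
      rw [Finset.prod_mul_distrib, Function.comp_apply, Finset.mul_sum, Real.exp_sum]
      congr 1
      refine Finset.prod_congr rfl fun j _ => ?_
      congr 1
      simp only [hc, interferenceTerm]
      split_ifs
      · ring
      · simp
  rw [← hpg, ← integral_indicator hA]
  refine tendsto_nhds_unique hL ?_
  simp only [hnet.integral_prod_mul_exp hvm hv0 hv1 hcm hc0, hcf]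
  exact hR'

end IsUAVNetwork

/-! ### Conditioning on a random radius -/

section RandomRadius

variable {Ω : Type*} [MeasurableSpace Ω] {μ : Measure Ω} [IsProbabilityMeasure μ] {R : Ω → ℝ}
  {Y : ℝ → Ω → ℝ} {Φ : ℝ → ℝ}

/-- If the mean of `Y t` on `{u ≤ R}` factorizes for every deterministic radius `t ≥ u`, then on
`{u ≤ R}` the random radius `R` may be inserted. -/
theorem setIntegral_random_radius (hR : Measurable R) (hΦ : Continuous Φ)
    (hΦ01 : ∀ t, Φ t ∈ Icc (0 : ℝ) 1)
    (hYm : ∀ ρ : Ω → ℝ, Measurable ρ → AEStronglyMeasurable (fun ω => Y (ρ ω) ω) μ)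
    (hY01 : ∀ᵐ ω ∂μ, ∀ t, Y t ω ∈ Icc (0 : ℝ) 1)
    (hYc : ∀ᵐ ω ∂μ, ∀ ρ : ℕ → ℝ, (∀ n, R ω ≤ ρ n) → Tendsto ρ atTop (𝓝 (R ω)) →
      Tendsto (fun n => Y (ρ n) ω) atTop (𝓝 (Y (R ω) ω)))
    (hfix : ∀ u t, 0 ≤ u → u ≤ t →
      ∫ ω in {ω | u ≤ R ω}, Y t ω ∂μ = Φ t * μ.real {ω | u ≤ R ω}) {u : ℝ} (hu : 0 ≤ u) :
    ∫ ω in {ω | u ≤ R ω}, Y (R ω) ω ∂μ = ∫ ω in {ω | u ≤ R ω}, Φ (R ω) ∂μ := by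
  have hS : ∀ a, MeasurableSet {ω | a ≤ R ω} := fun a => measurableSet_le measurable_const hR
  -- Rounds `R` up to the grid `u + k / (n + 1)`. The added one puts `ρ n` above `R`, the side on
  -- which `Y` is continuous and `hfix` applies.
  set ρ : ℕ → Ω → ℝ := fun n ω => u + ((⌊(R ω - u) * ((n : ℝ) + 1)⌋₊ : ℝ) + 1) / ((n : ℝ) + 1)
    with hρ
  have hρm : ∀ n, Measurable (ρ n) := fun n => by
    have h1 : Measurable fun ω => ⌊(R ω - u) * ((n : ℝ) + 1)⌋₊ :=
      Nat.measurable_floor.comp ((hR.sub_const u).mul_const _)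
    have h2 : Measurable fun ω => (⌊(R ω - u) * ((n : ℝ) + 1)⌋₊ : ℝ) :=
      (Measurable.of_discrete (f := fun k : ℕ => (k : ℝ))).comp h1
    exact ((h2.add_const 1).div_const _).const_add u
  have hYi : ∀ σ : Ω → ℝ, Measurable σ → Integrable (fun ω => Y (σ ω) ω) μ := fun σ hσ =>
    integrable_of_mem_Icc (hYm σ hσ) (hY01.mono fun ω hω => hω _)
  have hΦi : ∀ σ : Ω → ℝ, Measurable σ → Integrable (fun ω => Φ (σ ω)) μ := fun σ hσ =>
    integrable_of_mem_Icc (hΦ.measurable.comp hσ).aestronglyMeasurable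
      (ae_of_all _ fun ω => hΦ01 _)
  have hge : ∀ n ω, R ω ≤ ρ n ω := fun n ω => by
    have h1 := (Nat.lt_floor_add_one ((R ω - u) * ((n : ℝ) + 1))).le
    have h2 : (0 : ℝ) < (n : ℝ) + 1 := by positivity
    rw [hρ]
    have := (le_div_iff₀ h2).2 h1
    linarith
  have hlim : ∀ ω, u ≤ R ω → Tendsto (fun n => ρ n ω) atTop (𝓝 (R ω)) := by
    intro ω hω
    have h1 : Tendsto (fun n : ℕ => R ω + 1 / ((n : ℝ) + 1)) atTop (𝓝 (R ω)) := by
      simpa using tendsto_one_div_add_atTop_nhds_zero_nat.const_add (R ω)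
    refine tendsto_of_tendsto_of_tendsto_of_le_of_le tendsto_const_nhds h1 (fun n => hge n ω)
      fun n => ?_
    have h2 : (0 : ℝ) < (n : ℝ) + 1 := by positivity
    have h3 := (div_le_iff₀ h2).2
      (Nat.floor_le (mul_nonneg (sub_nonneg.2 hω) h2.le))
    simp only [hρ, add_div]
    linarith
  have hgrid : ∀ n, ∫ ω in {ω | u ≤ R ω}, Y (ρ n ω) ω ∂μ =
      ∫ ω in {ω | u ≤ R ω}, Φ (ρ n ω) ∂μ := by
    intro n
    have hn : (0 : ℝ) < (n : ℝ) + 1 := by positivity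
    set τ : ℕ → ℝ := fun k => u + (k : ℝ) / ((n : ℝ) + 1) with hτ
    have hτu : ∀ k, u ≤ τ k := fun k => by
      have : 0 ≤ (k : ℝ) / ((n : ℝ) + 1) := by positivity
      simp only [hτ]
      linarith
    have hτm : ∀ k, τ k ≤ τ (k + 1) := fun k => by
      simp only [hτ]
      gcongr
      simp
    set A : ℕ → Set Ω := fun k => {ω | u ≤ R ω} ∩ {ω | ⌊(R ω - u) * ((n : ℝ) + 1)⌋₊ = k} with hA
    have hAeq : ∀ k, A k = {ω | τ k ≤ R ω} \ {ω | τ (k + 1) ≤ R ω} := by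
      intro k
      ext ω
      have e1 : ∀ l : ℕ, τ l ≤ R ω ↔ (l : ℝ) ≤ (R ω - u) * ((n : ℝ) + 1) := fun l => by
        rw [← div_le_iff₀ hn]
        simp only [hτ]
        constructor <;> intro h <;> linarith
      have e2 : u ≤ R ω ↔ 0 ≤ (R ω - u) * ((n : ℝ) + 1) := by
        rw [mul_nonneg_iff_of_pos_right hn, sub_nonneg]
      simp only [hA, mem_inter_iff, mem_ofPred, Set.mem_sdiff, e1, e2, not_le]
      constructor
      · rintro ⟨h0, h1⟩
        rw [Nat.floor_eq_iff h0] at h1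
        exact_mod_cast h1
      · rintro ⟨h1, h2⟩
        have h0 : 0 ≤ (R ω - u) * ((n : ℝ) + 1) := (Nat.cast_nonneg k).trans h1
        exact ⟨h0, (Nat.floor_eq_iff h0).2 ⟨h1, by exact_mod_cast h2⟩⟩
    have hAm : ∀ k, MeasurableSet (A k) := fun k => by
      rw [hAeq]
      exact (hS _).diff (hS _)
    have hAd : Pairwise (Function.onFun Disjoint A) := fun k l hkl => by
      rw [Function.onFun, Set.disjoint_left]
      rintro ω ⟨_, h1⟩ ⟨_, h2⟩
      exact hkl (h1.symm.trans h2)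
    have hAU : {ω | u ≤ R ω} = ⋃ k, A k := by
      ext ω
      simp [hA]
    have hρA : ∀ k, ∀ ω ∈ A k, ρ n ω = τ (k + 1) := by
      rintro k ω ⟨_, h1⟩
      have h1 : ⌊(R ω - u) * ((n : ℝ) + 1)⌋₊ = k := h1
      simp only [hρ, hτ, h1]
      push_cast
      rfl
    have hsub : ∀ k, {ω | τ (k + 1) ≤ R ω} ⊆ {ω | τ k ≤ R ω} := fun k ω hω =>
      (hτm k).trans hω
    rw [hAU, integral_iUnion hAm hAd (hYi _ (hρm n)).integrableOn,
      integral_iUnion hAm hAd (hΦi _ (hρm n)).integrableOn]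
    refine tsum_congr fun k => ?_
    have i1 : ∫ ω in A k, Y (ρ n ω) ω ∂μ = ∫ ω in A k, Y (τ (k + 1)) ω ∂μ :=
      setIntegral_congr_fun (hAm k) fun ω hω => by simp only [hρA k ω hω]
    have i2 : ∫ ω in A k, Φ (ρ n ω) ∂μ = ∫ _ in A k, Φ (τ (k + 1)) ∂μ :=
      setIntegral_congr_fun (hAm k) fun ω hω => by simp only [hρA k ω hω]
    -- The cell is a difference of two events of the form `a ≤ R`, and `hfix` applies to both with
    -- the same radius `τ (k + 1)`.
    rw [i1, i2, setIntegral_const, hAeq, setIntegral_sdiff (hS _) (hYi _ measurable_const).integrableOn (hsub k),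
      hfix _ _ (hu.trans (hτu k)) (hτm k), hfix _ _ (hu.trans (hτu _)) le_rfl,
      measureReal_sdiff (hsub k) (hS _), smul_eq_mul]
    ring
  have hL : Tendsto (fun n => ∫ ω in {ω | u ≤ R ω}, Y (ρ n ω) ω ∂μ) atTop
      (𝓝 (∫ ω in {ω | u ≤ R ω}, Y (R ω) ω ∂μ)) := by
    refine tendsto_integral_of_mem_Icc (fun n => (hYm _ (hρm n)).restrict)
      (fun n => ae_restrict_of_ae (hY01.mono fun ω hω => hω _)) ?_
    filter_upwards [ae_restrict_of_ae hYc, ae_restrict_mem (hS u)] with ω hω hωu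
    exact hω _ (fun n => hge n ω) (hlim ω hωu)
  have hR' : Tendsto (fun n => ∫ ω in {ω | u ≤ R ω}, Φ (ρ n ω) ∂μ) atTop
      (𝓝 (∫ ω in {ω | u ≤ R ω}, Φ (R ω) ∂μ)) := by
    refine tendsto_integral_of_mem_Icc (fun n => (hΦi _ (hρm n)).aestronglyMeasurable.restrict)
      (fun n => ae_of_all _ fun ω => hΦ01 _) ?_
    filter_upwards [ae_restrict_mem (hS u)] with ω hωu
    exact (hΦ.tendsto _).comp (hlim ω hωu)
  refine tendsto_nhds_unique hL ?_
  simp only [hgrid]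
  exact hR'

/-- The half-lines `Ici u` form a π-system generating the Borel sets, so agreement on their
preimages suffices; a negative `u` reduces to zero because `R` is nonnegative. -/
theorem condExp_random_radius (hR : Measurable R) (hR0 : ∀ ω, 0 ≤ R ω) (hΦ : Continuous Φ)
    (hΦ01 : ∀ t, Φ t ∈ Icc (0 : ℝ) 1)
    (hYm : ∀ ρ : Ω → ℝ, Measurable ρ → AEStronglyMeasurable (fun ω => Y (ρ ω) ω) μ)
    (hY01 : ∀ᵐ ω ∂μ, ∀ t, Y t ω ∈ Icc (0 : ℝ) 1)
    (hYc : ∀ᵐ ω ∂μ, ∀ ρ : ℕ → ℝ, (∀ n, R ω ≤ ρ n) → Tendsto ρ atTop (𝓝 (R ω)) →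
      Tendsto (fun n => Y (ρ n) ω) atTop (𝓝 (Y (R ω) ω)))
    (hfix : ∀ u t, 0 ≤ u → u ≤ t →
      ∫ ω in {ω | u ≤ R ω}, Y t ω ∂μ = Φ t * μ.real {ω | u ≤ R ω}) :
    μ[fun ω => Y (R ω) ω | MeasurableSpace.comap R inferInstance] =ᵐ[μ] fun ω => Φ (R ω) := by
  have hYi : Integrable (fun ω => Y (R ω) ω) μ :=
    integrable_of_mem_Icc (hYm R hR) (hY01.mono fun ω hω => hω _)
  have hΦi : Integrable (fun ω => Φ (R ω)) μ :=
    integrable_of_mem_Icc (hΦ.measurable.comp hR).aestronglyMeasurable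
      (ae_of_all _ fun ω => hΦ01 _)
  have hge : ∀ u, ∫ ω in R ⁻¹' Ici u, Φ (R ω) ∂μ = ∫ ω in R ⁻¹' Ici u, Y (R ω) ω ∂μ := by
    intro u
    rcases le_total 0 u with hu | hu
    · exact (setIntegral_random_radius hR hΦ hΦ01 hYm hY01 hYc hfix hu).symm
    · have e : R ⁻¹' Ici u = {ω | 0 ≤ R ω} := by
        ext ω
        simp [hR0 ω, hu.trans (hR0 ω)]
      rw [e]
      exact (setIntegral_random_radius hR hΦ hΦ01 hYm hY01 hYc hfix le_rfl).symm
  have huniv : ∫ ω, Φ (R ω) ∂μ = ∫ ω, Y (R ω) ω ∂μ := by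
    have h := hge 0
    have e : R ⁻¹' Ici 0 = univ := by
      ext ω
      simp [hR0 ω]
    rwa [e, setIntegral_univ, setIntegral_univ] at h
  have key : ∀ B : Set ℝ, MeasurableSet B →
      ∫ ω in R ⁻¹' B, Φ (R ω) ∂μ = ∫ ω in R ⁻¹' B, Y (R ω) ω ∂μ := by
    intro B hB
    induction B, hB using MeasurableSpace.induction_on_inter
      ((BorelSpace.measurable_eq (α := ℝ)).trans (borel_eq_generateFrom_Ici ℝ)) isPiSystem_Ici with
    | empty => simp
    | basic B hB =>
      obtain ⟨u, rfl⟩ := hB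
      exact hge u
    | compl B hB ih =>
      rw [preimage_compl]
      have h1 := integral_add_compl (hR hB) hΦi
      have h2 := integral_add_compl (hR hB) hYi
      linarith
    | iUnion f hd hm ih =>
      have hd' : Pairwise (Function.onFun Disjoint fun k => R ⁻¹' f k) := fun k l hkl =>
        (hd hkl).preimage R
      rw [preimage_iUnion, integral_iUnion (fun k => hR (hm k)) hd' hΦi.integrableOn,
        integral_iUnion (fun k => hR (hm k)) hd' hYi.integrableOn]
      exact tsum_congr ih
  symm
  refine ae_eq_condExp_of_forall_setIntegral_eq hR.comap_le hYi
    (fun _ _ _ => hΦi.integrableOn) ?_ ?_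
  · rintro _ ⟨B, hB, rfl⟩ _
    exact key B hB
  · exact (hΦ.measurable.comp (comap_measurable R)).aestronglyMeasurable

end RandomRadius

/-! ### The Laplace transform at a fixed radius and at the nearest-point radius -/

namespace IsUAVNetwork

variable {Ω : Type*} [MeasurableSpace Ω] {μ : Measure Ω} [IsProbabilityMeasure μ]
  {X : ℕ → Ω → Plane} {G : ℕ → Ω → ℝ} {lam P α h : ℝ}

theorem integral_exp_interference (hnet : IsUAVNetwork μ X G lam 1) (hlam : 0 ≤ lam)
    (hα : 2 < α) (hh : 0 < h) (hP : 0 ≤ P) {s : ℝ} (hs : 0 ≤ s) {r : ℝ} (hr : 0 ≤ r) :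
    ∫ ω, Real.exp (-s * interference P α h r (fun j => X j ω) (fun j => G j ω)) ∂μ =
      Real.exp (-(lam * effectiveArea α h (s * P) r)) := by
  -- For `u = 0` the conditioning event is the whole space.
  have key := hnet.setIntegral_exp_interference hlam hα hh hP hs (u := 0) hr hr
  have e : {ω | 0 ≤ nearestDist fun j => X j ω} = univ := by
    ext ω
    simp [nearestDist_nonneg]
  rwa [e, setIntegral_univ, probReal_univ, mul_one] at key

theorem condExp_exp_interference (hnet : IsUAVNetwork μ X G lam 1) (hlam : 0 ≤ lam)
    (hα : 2 < α) (hh : 0 < h) (hP : 0 ≤ P) {s : ℝ} (hs : 0 ≤ s) :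
    μ[fun ω => Real.exp (-s * interference P α h (nearestDist fun j => X j ω)
        (fun j => X j ω) (fun j => G j ω)) |
      MeasurableSpace.comap (fun ω => nearestDist fun j => X j ω) inferInstance] =ᵐ[μ]
    fun ω => Real.exp (-(lam * effectiveArea α h (s * P) (nearestDist fun j => X j ω))) := by
  have hsP : 0 ≤ s * P := mul_nonneg hs hP
  -- A nonnegative exponent places `Φ` in `[0, 1]`.
  have hint : ∀ r, 0 ≤ effectiveArea α h (s * P) r := fun r => by
    rw [effectiveArea]
    have hα0 : 0 < α := by linarith
    have hd := linkDist_pos hh r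
    have h1 : 0 ≤ radialIntegral (1 - 2 / α) (s * P * linkDist h r ^ (-α)) :=
      intervalIntegral.integral_nonneg (by positivity) fun v hv => by
        have := hv.1
        positivity
    have := Real.pi_pos
    positivity
  refine condExp_random_radius
    (Y := fun t ω => Real.exp (-s * interference P α h t (fun j => X j ω) (fun j => G j ω)))
    (Φ := fun t => Real.exp (-(lam * effectiveArea α h (s * P) t)))
    (measurable_nearestDist hnet.hppp.measurable) (fun _ => nearestDist_nonneg _)
    (((continuous_effectiveArea hα hh hsP).const_mul lam).neg.rexp)
    (fun t => ⟨(Real.exp_pos _).le, Real.exp_le_one_iff.2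
      (neg_nonpos.2 (mul_nonneg hlam (hint t)))⟩)
    (fun ρ hρ => hnet.aestronglyMeasurable_exp_interference hlam hα hh s hρ) ?_ ?_
    (fun u t hu hut => hnet.setIntegral_exp_interference hlam hα hh hP hs (hu.trans hut) hut)
  · filter_upwards [hnet.ae_gain_nonneg] with ω hω t
    exact exp_neg_interference_mem_Icc hP hω hs t
  · filter_upwards [hnet.ae_gain_nonneg, hnet.ae_summable_linkDist hlam hα hh] with ω hω hsum ρ h1 h2
    exact (Real.continuous_exp.tendsto _).comp
      ((tendsto_interference hP hω hsum (nearestDist_nonneg _) h1 h2).const_mul (-s))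

end IsUAVNetwork

end

theorem corollary1 {Ω : Type*} [MeasurableSpace Ω] (μ : Measure Ω) [IsProbabilityMeasure μ]
    (X : ℕ → Ω → Plane) (G : ℕ → Ω → ℝ) (lam h P : ℝ) (hlam : 0 < lam) (hh : 0 < h) (hP : 0 < P)
    (hnet : IsUAVNetwork μ X G lam 1) :
    -- the interference is almost surely a convergent sum, for a given serving distance
    -- and for the distance to the nearest UAV
    (∀ αI : ℝ, 2 < αI →
      (∀ r : ℝ, 0 ≤ r → ∀ᵐ ω ∂μ,
        Summable (interferenceTerm P αI h r (fun j => X j ω) (fun j => G j ω))) ∧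
      (∀ᵐ ω ∂μ, Summable (interferenceTerm P αI h (nearestDist fun j => X j ω)
        (fun j => X j ω) (fun j => G j ω)))) ∧
    -- Laplace transform for a given serving distance
    (∀ r : ℝ, 0 ≤ r → ∀ s : ℝ, 0 ≤ s →
      (∀ αI : ℝ, 2 < αI →
        ∫ ω, Real.exp (-s * interference P αI h r (fun j => X j ω) (fun j => G j ω)) ∂μ =
          Real.exp (-(2 * Real.pi * lam * (s * P) * linkDist h r ^ (2 - αI)
              / (αI * (1 - 2 / αI)))
            * gauss2F1 1 (1 - 2 / αI) (2 - 2 / αI) (-(s * P * linkDist h r ^ (-αI))))) ∧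
      ∫ ω, Real.exp (-s * interference P 4 h r (fun j => X j ω) (fun j => G j ω)) ∂μ =
        Real.exp (-(Real.pi * lam * √(s * P)
          * Real.arctan (√(s * P) / linkDist h r ^ 2)))) ∧
    -- Laplace transform conditioned on the distance to the serving (nearest) UAV
    (∀ s : ℝ, 0 ≤ s →
      (∀ αI : ℝ, 2 < αI →
        μ[fun ω => Real.exp (-s * interference P αI h (nearestDist fun j => X j ω)
            (fun j => X j ω) (fun j => G j ω)) |
          MeasurableSpace.comap (fun ω => nearestDist fun j => X j ω) inferInstance] =ᵐ[μ]
        fun ω => Real.exp (-(2 * Real.pi * lam * (s * P)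
              * linkDist h (nearestDist fun j => X j ω) ^ (2 - αI) / (αI * (1 - 2 / αI)))
            * gauss2F1 1 (1 - 2 / αI) (2 - 2 / αI)
              (-(s * P * linkDist h (nearestDist fun j => X j ω) ^ (-αI))))) ∧
      μ[fun ω => Real.exp (-s * interference P 4 h (nearestDist fun j => X j ω)
          (fun j => X j ω) (fun j => G j ω)) |
        MeasurableSpace.comap (fun ω => nearestDist fun j => X j ω) inferInstance] =ᵐ[μ]
      fun ω => Real.exp (-(Real.pi * lam * √(s * P)
        * Real.arctan (√(s * P) / linkDist h (nearestDist fun j => X j ω) ^ 2)))) := by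
  have hl := hlam.le
  have hp := hP.le
  have hexp : ∀ αI : ℝ, 2 < αI → ∀ s : ℝ, 0 ≤ s → ∀ r : ℝ,
      lam * effectiveArea αI h (s * P) r = 2 * Real.pi * lam * (s * P) * linkDist h r ^ (2 - αI)
        / (αI * (1 - 2 / αI)) *
        gauss2F1 1 (1 - 2 / αI) (2 - 2 / αI) (-(s * P * linkDist h r ^ (-αI))) := by
    intro αI hα s hs r
    rw [effectiveArea_eq_gauss2F1 hα hh (mul_nonneg hs hp)]
    ring
  have hexp4 : ∀ s : ℝ, 0 ≤ s → ∀ r : ℝ, lam * effectiveArea 4 h (s * P) r =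
      Real.pi * lam * √(s * P) * Real.arctan (√(s * P) / linkDist h r ^ 2) := by
    intro s hs r
    rw [effectiveArea_four hh (mul_nonneg hs hp)]
    ring
  refine ⟨fun αI hα => ⟨fun r _ => ?_, ?_⟩, fun r hr s hs => ⟨fun αI hα => ?_, ?_⟩,
    fun s hs => ⟨fun αI hα => ?_, ?_⟩⟩
  · filter_upwards [hnet.ae_summable_linkDist hl hα hh] with ω hω
    exact summable_interferenceTerm hω r
  · filter_upwards [hnet.ae_summable_linkDist hl hα hh] with ω hω
    exact summable_interferenceTerm hω _
  · rw [hnet.integral_exp_interference hl hα hh hp hs hr, hexp αI hα s hs, neg_mul]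
  · rw [hnet.integral_exp_interference hl (by norm_num) hh hp hs hr, hexp4 s hs]
  · have key := hnet.condExp_exp_interference hl hα hh hp hs
    simpa only [hexp αI hα s hs, neg_mul] using key
  · have key := hnet.condExp_exp_interference hl (by norm_num : (2 : ℝ) < 4) hh hp hs
    simpa only [hexp4 s hs] using key
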